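/- Let $c\ge 4$ be real and, for $u\in[-\frac c2,\frac c2]$, let $$V_0(u)=\tfrac14\left[\left(\tfrac c2+u\right)\ln\left(\tfrac c2+u\right)+\left(\tfrac c2-u\right)\ln\left(\tfrac c2-u\right)\right],\qquad 0\ln 0:=0.$$ For a probability density $\sigma$ on $[-\frac c2,\frac c2]$ (that is, $\sigma$ is integrable there, $\sigma\ge 0$ almost everywhere and $\int_{-c/2}^{c/2}\sigma=1$) put $$E_c[\sigma]=\frac12\int_{-c/2}^{c/2}\int_{-c/2}^{c/2}\sigma(x)\sigma(y)\ln|x-y|^{-1}\,dx\,dy+\int_{-c/2}^{c/2}\sigma(x)V_0(x)\,dx\in(-\infty,+\infty].$$ For $0<a\le\frac c2$ let $$\rho_a(x)=\frac1{\pi^2}\,\Re\left[\sqrt{a^2-x^2}\;\,\mathrm{p.v.}\!\int_{-a}^{a}\frac{\frac14\left(\ln\left(\frac c2+s\right)-\ln\left(\frac c2-s\right)\right)}{\sqrt{a^2-s^2}\,(s-x)}\,ds\right]\quad(|x|<a),\qquad \rho_a(x)=0\quad(|x|\ge a).$$ 1. For every $0<a\le\frac c2$ the principal value integral exists for all $|x|<a$,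 $\rho_a$ is integrable on $\mathbb R$, and $\int_{\mathbb R}\rho_a(x)\,dx=1$ if and only if $a=\sqrt{2c-4}$. 2. One has $0<\sqrt{2c-4}\le\frac c2$, and $\rho:=\rho_{\sqrt{2c-4}}$ has support (closure of $\{\rho\neq0\}$) equal to $[-\sqrt{2c-4},\sqrt{2c-4}]$. 3. $\rho$ is a probability density on $[-\frac c2,\frac c2]$ with $E_c[\rho]<\infty$, and it is the unique minimizer of $E_c$: for every probability density $\sigma$ on $[-\frac c2,\frac c2]$ one has $E_c[\rho]\le E_c[\sigma]$, and if equality holds then $\sigma=\rho$ almost everywhere on $[-\frac c2,\frac c2]$. -/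

import Mathlib

open MeasureTheory Set Filter Topology

noncomputable section

namespace LogEnergy

/-- The external potential `V₀(u) = ¼[(c/2+u) ln(c/2+u) + (c/2-u) ln(c/2-u)]` on `[-c/2, c/2]`
(at the endpoints `0 * log 0 = 0`, the continuous extension). -/
def V₀ (c u : ℝ) : ℝ :=
  (1 / 4) * ((c / 2 + u) * Real.log (c / 2 + u) + (c / 2 - u) * Real.log (c / 2 - u))

/-- Lebesgue measure on the interval `[-c/2, c/2]`. -/
def intervalMeasure (c : ℝ) : Measure ℝ := volume.restrict (Icc (-(c / 2)) (c / 2))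

/-- `ρ` is a probability density on `[-c/2, c/2]`; its values outside are irrelevant. -/
structure IsProbDensity (c : ℝ) (ρ : ℝ → ℝ) : Prop where
  integrable : Integrable ρ (intervalMeasure c)
  nonneg : ∀ᵐ x ∂(intervalMeasure c), 0 ≤ ρ x
  integral_eq_one : ∫ x, ρ x ∂(intervalMeasure c) = 1

/-- The double integral `∬ ρ(x) ρ(y) ln |x-y|⁻¹ dx dy` over `[-c/2, c/2]²` converges absolutely. -/
def HasFiniteLogEnergy (c : ℝ) (ρ : ℝ → ℝ) : Prop :=
  Integrable (fun p : ℝ × ℝ => ρ p.1 * ρ p.2 * Real.log (|p.1 - p.2|⁻¹))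
    ((intervalMeasure c).prod (intervalMeasure c))

open Classical in
/-- The logarithmic energy functional
`½ ∬ ρ(x) ρ(y) ln |x-y|⁻¹ dx dy + ∫ ρ(x) V₀(x) dx`, all integrals over `[-c/2, c/2]`.
For a probability density on this interval the negative part of the double integral is finite
(as `ln |x-y|⁻¹ ≥ -ln c`) and the potential term is finite (as `V₀` is bounded), so the functional
has a value in `(-∞, +∞]`, and it is `+∞` exactly when the double integral does not converge
absolutely. -/
def energy (c : ℝ) (ρ : ℝ → ℝ) : EReal :=
  if HasFiniteLogEnergy c ρ then
    (((1 / 2) * (∫ x, ∫ y, ρ x * ρ y * Real.log (|x - y|⁻¹) ∂(intervalMeasure c)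
        ∂(intervalMeasure c))
      + ∫ x, ρ x * V₀ c x ∂(intervalMeasure c) : ℝ) : EReal)
  else ⊤

/-- The part of `(-a, a)` at distance more than `ε` from `x`. -/
def truncated (a x ε : ℝ) : Set ℝ := {s | s ∈ Ioo (-a) a ∧ ε < |s - x|}

/-- The Cauchy principal value at `x` of `∫_{-a}^{a} f(s) ds` exists and equals `L`. -/
def HasPV (a x : ℝ) (f : ℝ → ℝ) (L : ℝ) : Prop :=
  (∀ ε : ℝ, 0 < ε → IntegrableOn f (truncated a x ε)) ∧
    Tendsto (fun ε : ℝ => ∫ s in truncated a x ε, f s) (𝓝[>] 0) (𝓝 L)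

/-- The value of the principal value integral (meaningful when it exists). -/
def pv (a x : ℝ) (f : ℝ → ℝ) : ℝ :=
  limUnder (𝓝[>] (0 : ℝ)) (fun ε : ℝ => ∫ s in truncated a x ε, f s)

/-- The integrand `¼ (ln(c/2+s) - ln(c/2-s)) / (√(a²-s²) (s-x))`. -/
def kernel (c a x s : ℝ) : ℝ :=
  (1 / 4) * (Real.log (c / 2 + s) - Real.log (c / 2 - s)) / (√(a ^ 2 - s ^ 2) * (s - x))

/-- The function
`x ↦ π⁻² Re [ √(a²-x²) p.v.∫_{-a}^{a} ¼ (ln(c/2+s) - ln(c/2-s)) / (√(a²-s²) (s-x)) ds ]`.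
For `|x| > a` the square root is purely imaginary and the integral is real, so that the real part
vanishes; this is what the real square root, which is `0` at negative arguments, gives too. -/
def density (c a x : ℝ) : ℝ :=
  (1 / Real.pi ^ 2) * (√(a ^ 2 - x ^ 2) * pv a x (kernel c a x))

end LogEnergy

end

/-! Write A = c/2 and v = V₀' (`field`). The argument has three independent ingredients.

Closed form. The kernel 1/(√(a²-s²)(s-x)) has principal value zero, so v(s) may be replaced by v(s)
- v(x), and an ordinary integral of the slope of v remains. That slope is a positive superposition
over t > A of rational functions of s. Exchanging integrals gives `equilibriumDensity`, (π/2 -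
arctan(√(A²-a²)/√(a²-x²)))/(2π) (`hasPV_kernel`).

Euler–Lagrange conditions. This density is a mixture of arcsine laws on [-b,b], 0 < b < a, with
weight b/(2√(A²-b²)). Its mass is therefore (A-√(A²-a²))/2, which is 1 exactly when a² = 4A-4 =
2c-4. The arcsine law on [-b,b] has potential log(b/2) + arcosh(|x|/b), the second term being absent
for |x| ≤ b, and the integral of the weight times arcosh(x/b) over all b < x is V₀(x) - V₀(0). Hence
V₀ - ∫ρ(y) log|x-y| dy is constant on [-a,a] and at least that constant on [-A,A]
(`V₀_sub_equilibriumPotential_eq`, `V₀_sub_equilibriumPotential_ge`).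

Strict convexity. On distances less than 2c, -log u is a superposition of tents (r-u)₊, up to a
constant and a multiple of u. Tents are positive definite; for f of mean zero the constant drops out
and the linear term yields (1/c)∫F², with F the tail integral of f (`integral_mul_log_sub_le`).
Expanding the energy around ρ then gives E[σ] ≥ E[ρ] + (1/2c)∫F² for f = σ - ρ (`energy_sub_ge`),
hence minimality, and uniqueness because F = 0 forces f = 0 almost everywhere. -/

/-! ### Calculus on open intervals with singular endpoints -/

/-- A nonnegative derivative is integrable as soon as its primitive has finite limits, so inverse
square root singularities at the endpoints need no estimate of their own. -/
theorem integrableOn_Ioo_deriv_of_nonneg_of_tendsto {f f' : ℝ → ℝ} {a b fa fb : ℝ} (hab : a < b)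
    (hderiv : ∀ x ∈ Ioo a b, HasDerivAt f (f' x) x) (hpos : ∀ x ∈ Ioo a b, 0 ≤ f' x)
    (ha : Tendsto f (𝓝[>] a) (𝓝 fa)) (hb : Tendsto f (𝓝[<] b) (𝓝 fb)) :
    IntegrableOn f' (Ioo a b) := by
  set F : ℝ → ℝ := Function.update (Function.update f a fa) b fb
  have Fderiv : ∀ x ∈ Ioo a b, HasDerivAt F (f' x) x := by
    refine fun x hx => (hderiv x hx).congr_of_eventuallyEq ?_
    filter_upwards [Ioo_mem_nhds hx.1 hx.2] with _ hy
    unfold F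
    rw [Function.update_of_ne hy.2.ne, Function.update_of_ne hy.1.ne']
  have hcont : ContinuousOn F (Icc a b) := by
    rw [continuousOn_update_iff, continuousOn_update_iff, Icc_sdiff_right, Ico_sdiff_left]
    refine ⟨⟨fun z hz => (hderiv z hz).continuousAt.continuousWithinAt, ?_⟩, ?_⟩
    · exact fun _ => ha.mono_left (nhdsWithin_mono _ Ioo_subset_Ioi_self)
    · rintro -
      refine (hb.congr' ?_).mono_left (nhdsWithin_mono _ Ico_subset_Iio_self)
      filter_upwards [Ioo_mem_nhdsLT hab] with _ hz using (Function.update_of_ne hz.1.ne' _ _).symm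
  exact (intervalIntegral.integrableOn_deriv_of_nonneg hcont Fderiv hpos).mono_set Ioo_subset_Ioc_self

theorem integral_Ioo_eq_sub_of_hasDerivAt_of_nonneg_of_tendsto {f f' : ℝ → ℝ} {a b fa fb : ℝ}
    (hab : a < b) (hderiv : ∀ x ∈ Ioo a b, HasDerivAt f (f' x) x) (hpos : ∀ x ∈ Ioo a b, 0 ≤ f' x)
    (ha : Tendsto f (𝓝[>] a) (𝓝 fa)) (hb : Tendsto f (𝓝[<] b) (𝓝 fb)) :
    ∫ x in Ioo a b, f' x = fb - fa := by
  have hint := integrableOn_Ioo_deriv_of_nonneg_of_tendsto hab hderiv hpos ha hb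
  rw [← integral_Ioc_eq_integral_Ioo, ← intervalIntegral.integral_of_le hab.le]
  exact intervalIntegral.integral_eq_sub_of_hasDerivAt_of_tendsto hab hderiv
    ((intervalIntegrable_iff_integrableOn_Ioo_of_le hab.le).2 hint) ha hb

theorem integral_Ioo_neg_eq_zero_of_odd {f : ℝ → ℝ} (a : ℝ) (hf : ∀ x, f (-x) = -f x) :
    ∫ x in Ioo (-a) a, f x = 0 := by
  rcases le_or_gt a 0 with ha | ha
  · rw [Ioo_eq_empty (by linarith)]; simp
  · rw [← integral_Ioc_eq_integral_Ioo, ← intervalIntegral.integral_of_le (by linarith)]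
    have h := intervalIntegral.integral_comp_neg f (a := -a) (b := a)
    simp only [hf, neg_neg, intervalIntegral.integral_neg] at h
    linarith

theorem sqrt_sq_sub_sq_pos {a s : ℝ} (hs : s ∈ Ioo (-a) a) : 0 < √(a ^ 2 - s ^ 2) :=
  Real.sqrt_pos.2 (by nlinarith [hs.1, hs.2])

theorem sq_sub_sq_pos {a s : ℝ} (hs : s ∈ Ioo (-a) a) : 0 < a ^ 2 - s ^ 2 := by
  nlinarith [hs.1, hs.2]

theorem hasDerivAt_sqrt_sq_sub_sq {a s : ℝ} (hs : s ∈ Ioo (-a) a) :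
    HasDerivAt (fun s => √(a ^ 2 - s ^ 2)) (-s / √(a ^ 2 - s ^ 2)) s := by
  have h := ((hasDerivAt_id s).pow 2).const_sub (a ^ 2)
  have h2 := h.sqrt (sq_sub_sq_pos hs).ne'
  refine h2.congr_deriv ?_
  have := (sqrt_sq_sub_sq_pos hs).ne'
  simp
  field_simp

theorem hasDerivAt_sqrt_sq_sub_sq' {a t : ℝ} (ha : 0 ≤ a) (ht : a < t) :
    HasDerivAt (fun t => √(t ^ 2 - a ^ 2)) (t / √(t ^ 2 - a ^ 2)) t := by
  have h0 : 0 < t ^ 2 - a ^ 2 := by nlinarith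
  have h := ((hasDerivAt_id t).pow 2).sub_const (a ^ 2)
  have h2 := h.sqrt h0.ne'
  refine h2.congr_deriv ?_
  have := (Real.sqrt_pos.2 h0).ne'
  simp
  field_simp

/-! ### The vanishing principal value of the arcsine Cauchy kernel -/

theorem pv_denominator_pos {a x s : ℝ} (hx : x ∈ Ioo (-a) a) (hs : s ∈ Icc (-a) a) :
    0 < a ^ 2 - x * s + √(a ^ 2 - x ^ 2) * √(a ^ 2 - s ^ 2) := by
  have : 0 ≤ √(a ^ 2 - x ^ 2) * √(a ^ 2 - s ^ 2) := by positivity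
  have h2 : x * s < a ^ 2 := by
    have hsa : |s| ≤ a := abs_le.2 hs
    have hxa : |x| < a := abs_lt.2 hx
    calc x * s ≤ |x * s| := le_abs_self _
      _ = |x| * |s| := abs_mul _ _
      _ ≤ |x| * a := by gcongr
      _ < a * a := by gcongr; exact (abs_nonneg _).trans_lt hxa
      _ = a ^ 2 := by ring
  linarith

/-- A primitive of `1 / (√(a² - s²) (s - x))` away from `x`. -/
noncomputable def cauchyPrimitive (a x s : ℝ) : ℝ :=
  (Real.log (s - x) - Real.log (a ^ 2 - x * s + √(a ^ 2 - x ^ 2) * √(a ^ 2 - s ^ 2))) /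
    √(a ^ 2 - x ^ 2)

theorem hasDerivAt_cauchyPrimitive {a x s : ℝ} (hx : x ∈ Ioo (-a) a) (hs : s ∈ Ioo (-a) a)
    (hsx : s ≠ x) :
    HasDerivAt (cauchyPrimitive a x) (1 / (√(a ^ 2 - s ^ 2) * (s - x))) s := by
  have hr := sqrt_sq_sub_sq_pos hx
  have hq := sqrt_sq_sub_sq_pos hs
  have hD := pv_denominator_pos hx (Ioo_subset_Icc_self hs)
  have hsx' : s - x ≠ 0 := sub_ne_zero.2 hsx
  have h1 := ((hasDerivAt_id s).sub_const x).log hsx'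
  have h2 := ((((hasDerivAt_id s).const_mul x).const_sub (a ^ 2)).add
    ((hasDerivAt_sqrt_sq_sub_sq hs).const_mul √(a ^ 2 - x ^ 2))).log hD.ne'
  refine ((h1.sub h2).div_const √(a ^ 2 - x ^ 2)).congr_deriv ?_
  have hr2 : √(a ^ 2 - x ^ 2) ^ 2 = a ^ 2 - x ^ 2 := Real.sq_sqrt (sq_sub_sq_pos hx).le
  have hq2 : √(a ^ 2 - s ^ 2) ^ 2 = a ^ 2 - s ^ 2 := Real.sq_sqrt (sq_sub_sq_pos hs).le
  simp only [id, Pi.add_apply] at hD ⊢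
  generalize √(a ^ 2 - x ^ 2) = r at *
  generalize √(a ^ 2 - s ^ 2) = q at *
  have hD' : a ^ 2 - x * s + r * q ≠ 0 := hD.ne'
  rw [div_sub_div _ _ hsx' hD', div_div, div_eq_div_iff (by positivity) (by positivity)]
  field_simp
  linear_combination r * hq2 - q * hr2

theorem continuousOn_cauchyPrimitive {a x : ℝ} (hx : x ∈ Ioo (-a) a) :
    ContinuousOn (cauchyPrimitive a x) (Icc (-a) a \ {x}) := by
  unfold cauchyPrimitive
  refine ContinuousOn.div_const (ContinuousOn.sub (ContinuousOn.log (by fun_prop) ?_)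
    (ContinuousOn.log (by fun_prop) ?_)) _
  · exact fun s hs => sub_ne_zero.2 hs.2
  · exact fun s hs => (pv_denominator_pos hx hs.1).ne'

theorem cauchyPrimitive_right {a x : ℝ} (hx : x ∈ Ioo (-a) a) :
    cauchyPrimitive a x a = - Real.log a / √(a ^ 2 - x ^ 2) := by
  have ha : 0 < a := by linarith [hx.1, hx.2]
  have : a - x ≠ 0 := by linarith [hx.2]
  unfold cauchyPrimitive
  rw [show a ^ 2 - x * a + √(a ^ 2 - x ^ 2) * √(a ^ 2 - a ^ 2) = a * (a - x) by simp; ring,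
    Real.log_mul ha.ne' this]
  ring

theorem cauchyPrimitive_left {a x : ℝ} (hx : x ∈ Ioo (-a) a) :
    cauchyPrimitive a x (-a) = - Real.log a / √(a ^ 2 - x ^ 2) := by
  have ha : 0 < a := by linarith [hx.1, hx.2]
  have : a + x ≠ 0 := by linarith [hx.1]
  unfold cauchyPrimitive
  rw [show a ^ 2 - x * (-a) + √(a ^ 2 - x ^ 2) * √(a ^ 2 - (-a) ^ 2) = a * (a + x) by simp; ring,
    Real.log_mul ha.ne' this, show -a - x = -(a + x) by ring, Real.log_neg_eq_log]
  ring

theorem integrableOn_cauchy_left {a x ε : ℝ} (hx : x ∈ Ioo (-a) a) (hε : 0 < ε) :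
    IntegrableOn (fun s => 1 / (√(a ^ 2 - s ^ 2) * (s - x))) (Ioo (-a) (x - ε)) := by
  rcases le_or_gt (x - ε) (-a) with h | h
  · rw [Ioo_eq_empty (by linarith)]; simp
  have hsub : Icc (-a) (x - ε) ⊆ Icc (-a) a \ {x} := fun s hs =>
    ⟨⟨hs.1, by linarith [hs.2, hx.2]⟩, fun h => by linarith [hs.2, mem_singleton_iff.1 h]⟩
  have h1 := intervalIntegral.integrableOn_deriv_of_nonneg (g := fun s => -cauchyPrimitive a x s)
    (g' := fun s => -(1 / (√(a ^ 2 - s ^ 2) * (s - x)))) (a := -a) (b := x - ε)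
    ((continuousOn_cauchyPrimitive hx).mono hsub).neg
    (fun s hs => (hasDerivAt_cauchyPrimitive hx ⟨hs.1, by linarith [hs.2, hx.2]⟩
      (by linarith [hs.2])).neg)
    (fun s hs => by
      have := Real.sqrt_nonneg (a ^ 2 - s ^ 2)
      rw [neg_nonneg]
      exact div_nonpos_of_nonneg_of_nonpos zero_le_one
        (mul_nonpos_of_nonneg_of_nonpos this (by linarith [hs.2])))
  exact (integrable_neg_iff.1 h1).mono_measure
    (Measure.restrict_mono Ioo_subset_Ioc_self le_rfl)

theorem integral_cauchy_left {a x ε : ℝ} (hx : x ∈ Ioo (-a) a) (hε : 0 < ε)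
    (h : -a < x - ε) :
    ∫ s in Ioo (-a) (x - ε), 1 / (√(a ^ 2 - s ^ 2) * (s - x)) =
      cauchyPrimitive a x (x - ε) - cauchyPrimitive a x (-a) := by
  have hsub : Icc (-a) (x - ε) ⊆ Icc (-a) a \ {x} := fun s hs =>
    ⟨⟨hs.1, by linarith [hs.2, hx.2]⟩, fun h => by linarith [hs.2, mem_singleton_iff.1 h]⟩
  rw [← integral_Ioc_eq_integral_Ioo, ← intervalIntegral.integral_of_le h.le]
  exact intervalIntegral.integral_eq_sub_of_hasDerivAt_of_le h.le
    ((continuousOn_cauchyPrimitive hx).mono hsub)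
    (fun s hs => hasDerivAt_cauchyPrimitive hx ⟨hs.1, by linarith [hs.2, hx.2]⟩
      (by linarith [hs.2]))
    ((intervalIntegrable_iff_integrableOn_Ioo_of_le h.le).2 (integrableOn_cauchy_left hx hε))

theorem integrableOn_cauchy_right {a x ε : ℝ} (hx : x ∈ Ioo (-a) a) (hε : 0 < ε) :
    IntegrableOn (fun s => 1 / (√(a ^ 2 - s ^ 2) * (s - x))) (Ioo (x + ε) a) := by
  have hsub : Icc (x + ε) a ⊆ Icc (-a) a \ {x} := fun s hs =>
    ⟨⟨by linarith [hs.1, hx.1], hs.2⟩, fun h => by linarith [hs.1, mem_singleton_iff.1 h]⟩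
  have h1 := intervalIntegral.integrableOn_deriv_of_nonneg (g := fun s => cauchyPrimitive a x s)
    (g' := fun s => (1 / (√(a ^ 2 - s ^ 2) * (s - x)))) (a := x + ε) (b := a)
    ((continuousOn_cauchyPrimitive hx).mono hsub)
    (fun s hs => (hasDerivAt_cauchyPrimitive hx ⟨by linarith [hs.1, hx.1], hs.2⟩
      (by linarith [hs.1])))
    (fun s hs => by
      have := Real.sqrt_nonneg (a ^ 2 - s ^ 2)
      exact div_nonneg zero_le_one (mul_nonneg this (by linarith [hs.1])))
  exact h1.mono_set Ioo_subset_Ioc_self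

theorem integral_cauchy_right {a x ε : ℝ} (hx : x ∈ Ioo (-a) a) (hε : 0 < ε)
    (h : x + ε < a) :
    ∫ s in Ioo (x + ε) a, 1 / (√(a ^ 2 - s ^ 2) * (s - x)) =
      cauchyPrimitive a x a - cauchyPrimitive a x (x + ε) := by
  have hsub : Icc (x + ε) a ⊆ Icc (-a) a \ {x} := fun s hs =>
    ⟨⟨by linarith [hs.1, hx.1], hs.2⟩, fun h => by linarith [hs.1, mem_singleton_iff.1 h]⟩
  rw [← integral_Ioc_eq_integral_Ioo, ← intervalIntegral.integral_of_le h.le]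
  exact intervalIntegral.integral_eq_sub_of_hasDerivAt_of_le h.le
    ((continuousOn_cauchyPrimitive hx).mono hsub)
    (fun s hs => hasDerivAt_cauchyPrimitive hx ⟨by linarith [hs.1, hx.1], hs.2⟩
      (by linarith [hs.1]))
    ((intervalIntegrable_iff_integrableOn_Ioo_of_le h.le).2 (integrableOn_cauchy_right hx hε))

theorem truncated_eq {a x ε : ℝ} (hx : x ∈ Ioo (-a) a) (hε : 0 < ε) :
    LogEnergy.truncated a x ε = Ioo (-a) (x - ε) ∪ Ioo (x + ε) a := by
  ext s
  simp only [LogEnergy.truncated, mem_ofPred_eq, mem_union, mem_Ioo, lt_abs]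
  constructor
  · rintro ⟨⟨h1, h2⟩, h | h⟩
    · exact Or.inr ⟨by linarith, h2⟩
    · exact Or.inl ⟨h1, by linarith⟩
  · rintro (⟨h1, h2⟩ | ⟨h1, h2⟩)
    · exact ⟨⟨h1, by linarith [hx.2]⟩, Or.inr (by linarith)⟩
    · exact ⟨⟨by linarith [hx.1], h2⟩, Or.inl (by linarith)⟩

/-- The primitive takes the same value at a and -a, and its singular parts at x ± ε cancel because
`Real.log` ignores signs. What is left is a difference of values at x ± ε of a function continuous
at x. -/
theorem hasPV_cauchy {a x : ℝ} (hx : x ∈ Ioo (-a) a) :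
    LogEnergy.HasPV a x (fun s => 1 / (√(a ^ 2 - s ^ 2) * (s - x))) 0 := by
  refine ⟨fun ε hε => ?_, ?_⟩
  · rw [truncated_eq hx hε]
    exact (integrableOn_cauchy_left hx hε).union (integrableOn_cauchy_right hx hε)
  · have hr := sqrt_sq_sub_sq_pos hx
    let D : ℝ → ℝ := fun s =>
      Real.log (a ^ 2 - x * s + √(a ^ 2 - x ^ 2) * √(a ^ 2 - s ^ 2))
    have hD : ContinuousAt D x := by
      refine ContinuousAt.log (by fun_prop) (pv_denominator_pos hx (Ioo_subset_Icc_self hx)).ne'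
    have hlim : Tendsto (fun ε : ℝ => (D (x + ε) - D (x - ε)) / √(a ^ 2 - x ^ 2))
        (𝓝[>] 0) (𝓝 0) := by
      have h1 : Tendsto (fun ε : ℝ => D (x + ε)) (𝓝[>] 0) (𝓝 (D x)) := by
        refine hD.tendsto.comp (Tendsto.mono_left ?_ nhdsWithin_le_nhds)
        have : Continuous fun ε : ℝ => x + ε := by fun_prop
        simpa using this.tendsto 0
      have h2 : Tendsto (fun ε : ℝ => D (x - ε)) (𝓝[>] 0) (𝓝 (D x)) := by
        refine hD.tendsto.comp (Tendsto.mono_left ?_ nhdsWithin_le_nhds)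
        have : Continuous fun ε : ℝ => x - ε := by fun_prop
        simpa using this.tendsto 0
      simpa using (h1.sub h2).div_const √(a ^ 2 - x ^ 2)
    refine hlim.congr' ?_
    have hpos : 0 < min (x + a) (a - x) := lt_min (by linarith [hx.1]) (by linarith [hx.2])
    filter_upwards [Ioo_mem_nhdsGT hpos] with ε hε
    have hε1 := hε.2.trans_le (min_le_left _ _)
    have hε2 := hε.2.trans_le (min_le_right _ _)
    rw [truncated_eq hx hε.1, setIntegral_union _ measurableSet_Ioo
      (integrableOn_cauchy_left hx hε.1) (integrableOn_cauchy_right hx hε.1),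
      integral_cauchy_left hx hε.1 (by linarith), integral_cauchy_right hx hε.1 (by linarith),
      cauchyPrimitive_left hx, cauchyPrimitive_right hx]
    · simp only [cauchyPrimitive, D]
      rw [show x - ε - x = -ε by ring, show x + ε - x = ε by ring, Real.log_neg_eq_log]
      ring
    · rw [Set.disjoint_left]
      intro s h1 h2
      linarith [h1.2, h2.1, hε.1]

/-! ### The slope of the field integrated against the arcsine weight -/

theorem integrableOn_and_integral_arcsine_stieltjes {a t : ℝ} (ha : 0 < a) (ht : a < t) :
    IntegrableOn (fun s => 1 / ((t ^ 2 - s ^ 2) * √(a ^ 2 - s ^ 2))) (Ioo (-a) a) ∧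
    ∫ s in Ioo (-a) a, 1 / ((t ^ 2 - s ^ 2) * √(a ^ 2 - s ^ 2)) =
      Real.pi / (t * √(t ^ 2 - a ^ 2)) := by
  have hw0 : 0 < t ^ 2 - a ^ 2 := by nlinarith
  have hw := Real.sqrt_pos.2 hw0
  have hw2 : √(t ^ 2 - a ^ 2) ^ 2 = t ^ 2 - a ^ 2 := Real.sq_sqrt hw0.le
  have ht0 : 0 < t := by linarith
  set w := √(t ^ 2 - a ^ 2)
  -- The substitution u = s/√(a²-s²) turns the integrand into 1/(t² + w²u²).
  let F : ℝ → ℝ := fun s => Real.arctan (s * w / (t * √(a ^ 2 - s ^ 2))) / (t * w)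
  have hder : ∀ s ∈ Ioo (-a) a, HasDerivAt F (1 / ((t ^ 2 - s ^ 2) * √(a ^ 2 - s ^ 2))) s := by
    intro s hs
    have hq := sqrt_sq_sub_sq_pos hs
    have hq2 : √(a ^ 2 - s ^ 2) ^ 2 = a ^ 2 - s ^ 2 := Real.sq_sqrt (sq_sub_sq_pos hs).le
    have h1 := (((((hasDerivAt_id s).mul_const w).div
      ((hasDerivAt_sqrt_sq_sub_sq hs).const_mul t) (by positivity))).arctan).div_const (t * w)
    refine h1.congr_deriv ?_
    have hts : 0 < t ^ 2 - s ^ 2 := by nlinarith [sq_sub_sq_pos hs]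
    simp only [id, Pi.div_apply]
    clear h1
    generalize √(a ^ 2 - s ^ 2) = q at *
    have h3 : 1 + (s * w / (t * q)) ^ 2 = a ^ 2 * (t ^ 2 - s ^ 2) / (t * q) ^ 2 := by
      field_simp
      linear_combination s ^ 2 * hw2 + t ^ 2 * hq2
    rw [h3]
    field_simp
    linear_combination hq2
  have hpos : ∀ s ∈ Ioo (-a) a, 0 ≤ 1 / ((t ^ 2 - s ^ 2) * √(a ^ 2 - s ^ 2)) := by
    intro s hs
    have := sqrt_sq_sub_sq_pos hs
    have : 0 < t ^ 2 - s ^ 2 := by nlinarith [sq_sub_sq_pos hs]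
    positivity
  have hq0 : Continuous fun s : ℝ => t * √(a ^ 2 - s ^ 2) := by fun_prop
  have hb : Tendsto F (𝓝[<] a) (𝓝 (Real.pi / 2 / (t * w))) := by
    refine Tendsto.div_const ?_ _
    refine (Real.tendsto_arctan_atTop.mono_right nhdsWithin_le_nhds).comp ?_
    have h1 : Tendsto (fun s : ℝ => s * w) (𝓝[<] a) (𝓝 (a * w)) :=
      (by fun_prop : Continuous fun s : ℝ => s * w).continuousWithinAt
    have h2 : Tendsto (fun s : ℝ => t * √(a ^ 2 - s ^ 2)) (𝓝[<] a) (𝓝[>] 0) := by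
      refine tendsto_nhdsWithin_iff.2 ⟨?_, ?_⟩
      · simpa using (hq0.tendsto a).mono_left nhdsWithin_le_nhds
      · filter_upwards [Ioo_mem_nhdsLT (show -a < a by linarith)] with s hs
        exact mul_pos ht0 (sqrt_sq_sub_sq_pos hs)
    simpa [div_eq_mul_inv, Function.comp_def] using
      h1.pos_mul_atTop (by positivity) (tendsto_inv_nhdsGT_zero.comp h2)
  have ha' : Tendsto F (𝓝[>] (-a)) (𝓝 (-(Real.pi / 2) / (t * w))) := by
    have h1 : Tendsto (fun s => -F (-s)) (𝓝[>] (-a)) (𝓝 (-(Real.pi / 2 / (t * w)))) := by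
      refine Tendsto.neg (hb.comp ?_)
      simpa using tendsto_neg_nhdsGT (a := -a)
    convert h1 using 2
    · simp [F, neg_div, Real.arctan_neg]
    · ring
  refine ⟨integrableOn_Ioo_deriv_of_nonneg_of_tendsto (by linarith) hder hpos ha' hb, ?_⟩
  rw [integral_Ioo_eq_sub_of_hasDerivAt_of_nonneg_of_tendsto (by linarith) hder hpos ha' hb]
  ring

/-- The term s·x of the numerator is odd in s and integrates to zero against the even weight; the
term t² is the preceding integral. -/
theorem integrableOn_and_integral_arcsine_resolvent {a t x : ℝ} (ha : 0 < a) (ht : a < t)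
    (hx : x ∈ Ioo (-a) a) :
    IntegrableOn (fun s => (t ^ 2 + s * x) / ((t ^ 2 - s ^ 2) * (t ^ 2 - x ^ 2)) /
      √(a ^ 2 - s ^ 2)) (Ioo (-a) a) ∧
    ∫ s in Ioo (-a) a, (t ^ 2 + s * x) / ((t ^ 2 - s ^ 2) * (t ^ 2 - x ^ 2)) /
      √(a ^ 2 - s ^ 2) = Real.pi * (t / ((t ^ 2 - x ^ 2) * √(t ^ 2 - a ^ 2))) := by
  obtain ⟨h1, h2⟩ := integrableOn_and_integral_arcsine_stieltjes ha ht
  have ht0 : 0 < t := by linarith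
  have hodd : IntegrableOn (fun s => s * (1 / ((t ^ 2 - s ^ 2) * √(a ^ 2 - s ^ 2))))
      (Ioo (-a) a) := by
    refine h1.bdd_mul (c := a) (by fun_prop) ?_
    filter_upwards [ae_restrict_mem measurableSet_Ioo] with s hs
    exact abs_le.2 ⟨hs.1.le, hs.2.le⟩
  have hodd0 := integral_Ioo_neg_eq_zero_of_odd
    (f := fun s => s * (1 / ((t ^ 2 - s ^ 2) * √(a ^ 2 - s ^ 2)))) a (fun s => by simp)
  have heq : (fun s => (t ^ 2 + s * x) / ((t ^ 2 - s ^ 2) * (t ^ 2 - x ^ 2)) /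
      √(a ^ 2 - s ^ 2)) = fun s =>
      (t ^ 2 / (t ^ 2 - x ^ 2)) * (1 / ((t ^ 2 - s ^ 2) * √(a ^ 2 - s ^ 2))) +
      (x / (t ^ 2 - x ^ 2)) * (s * (1 / ((t ^ 2 - s ^ 2) * √(a ^ 2 - s ^ 2)))) := by
    funext s
    simp only [div_eq_mul_inv, mul_inv]
    ring
  rw [heq]
  refine ⟨(h1.const_mul _).add (hodd.const_mul _), ?_⟩
  rw [integral_add (h1.const_mul _) (hodd.const_mul _), integral_const_mul, integral_const_mul,
    h2, hodd0]
  have hw : 0 < √(t ^ 2 - a ^ 2) := Real.sqrt_pos.2 (by nlinarith)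
  have : 0 < t ^ 2 - x ^ 2 := by nlinarith [sq_sub_sq_pos hx]
  field_simp
  ring

theorem integrableOn_and_integral_Ioi_resolvent {A a x : ℝ} (ha : 0 < a) (hA : a ≤ A)
    (hx : x ∈ Ioo (-a) a) :
    IntegrableOn (fun t => t / ((t ^ 2 - x ^ 2) * √(t ^ 2 - a ^ 2))) (Ioi A) ∧
    ∫ t in Ioi A, t / ((t ^ 2 - x ^ 2) * √(t ^ 2 - a ^ 2)) =
      (Real.pi / 2 - Real.arctan (√(A ^ 2 - a ^ 2) / √(a ^ 2 - x ^ 2))) / √(a ^ 2 - x ^ 2) := by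
  have hr := sqrt_sq_sub_sq_pos hx
  have hr2 : √(a ^ 2 - x ^ 2) ^ 2 = a ^ 2 - x ^ 2 := Real.sq_sqrt (sq_sub_sq_pos hx).le
  set r := √(a ^ 2 - x ^ 2)
  let F : ℝ → ℝ := fun t => Real.arctan (√(t ^ 2 - a ^ 2) / r) / r
  have hder : ∀ t ∈ Ioi A, HasDerivAt F (t / ((t ^ 2 - x ^ 2) * √(t ^ 2 - a ^ 2))) t := by
    intro t ht
    have hat : a < t := hA.trans_lt ht
    have hw0 : 0 < t ^ 2 - a ^ 2 := by nlinarith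
    have hw := Real.sqrt_pos.2 hw0
    have hw2 : √(t ^ 2 - a ^ 2) ^ 2 = t ^ 2 - a ^ 2 := Real.sq_sqrt hw0.le
    have h1 := (((hasDerivAt_sqrt_sq_sub_sq' ha.le hat).div_const r).arctan).div_const r
    refine h1.congr_deriv ?_
    clear h1
    have htx : 0 < t ^ 2 - x ^ 2 := by nlinarith [sq_sub_sq_pos hx]
    generalize √(t ^ 2 - a ^ 2) = w at *
    have h3 : 1 + (w / r) ^ 2 = (t ^ 2 - x ^ 2) / r ^ 2 := by
      field_simp
      linear_combination hw2 + hr2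
    rw [h3]
    field_simp
  have hpos : ∀ t ∈ Ioi A, 0 ≤ t / ((t ^ 2 - x ^ 2) * √(t ^ 2 - a ^ 2)) := by
    intro t ht
    have hat : a < t := hA.trans_lt ht
    have htx : 0 < t ^ 2 - x ^ 2 := by nlinarith [sq_sub_sq_pos hx]
    have : 0 < t := by linarith
    positivity
  have hc : ContinuousWithinAt F (Ici A) A :=
    (by fun_prop : Continuous F).continuousWithinAt
  have hlim : Tendsto F atTop (𝓝 (Real.pi / 2 / r)) := by
    refine Tendsto.div_const ?_ _
    refine (Real.tendsto_arctan_atTop.mono_right nhdsWithin_le_nhds).comp ?_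
    refine Tendsto.atTop_div_const hr ?_
    refine Real.tendsto_sqrt_atTop.comp ?_
    exact tendsto_atTop_add_const_right _ _ (tendsto_pow_atTop two_ne_zero)
  refine ⟨integrableOn_Ioi_deriv_of_nonneg hc hder hpos hlim, ?_⟩
  rw [integral_Ioi_of_hasDerivAt_of_nonneg hc hder hpos hlim, sub_div]

theorem tendsto_log_sub_div_add_atTop (s : ℝ) :
    Tendsto (fun t => Real.log (t - s) - Real.log (t + s)) atTop (𝓝 0) := by
  have h1 : Tendsto (fun t : ℝ => 1 - 2 * s / (t + s)) atTop (𝓝 1) := by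
    have : Tendsto (fun t : ℝ => 2 * s / (t + s)) atTop (𝓝 0) :=
      Tendsto.const_div_atTop (tendsto_atTop_add_const_right _ _ tendsto_id) _
    simpa using this.const_sub 1
  have h2 := (Real.continuousAt_log one_ne_zero).tendsto.comp h1
  rw [Real.log_one] at h2
  refine h2.congr' ?_
  filter_upwards [eventually_gt_atTop |s|] with t ht
  have h3 : 0 < t - s := by linarith [le_abs_self s]
  have h4 : 0 < t + s := by linarith [neg_abs_le s]
  rw [Function.comp, ← Real.log_div h3.ne' h4.ne']
  congr 1
  field_simp
  ring

/-- The derivative of the external potential, in terms of the half-length of the interval. -/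
noncomputable def field (A s : ℝ) : ℝ := (1 / 4) * (Real.log (A + s) - Real.log (A - s))

/-- The integrand is the difference quotient between s and x of s/(t²-s²), whose integral over t > A
is 2·`field A s`. The point is its positivity, and that its dependence on s can be integrated in
closed form. -/
theorem integrableOn_and_integral_field_slope {A s x : ℝ} (hs : s ∈ Ioo (-A) A)
    (hx : x ∈ Ioo (-A) A) (hsx : s ≠ x) :
    IntegrableOn (fun t => (t ^ 2 + s * x) / ((t ^ 2 - s ^ 2) * (t ^ 2 - x ^ 2))) (Ioi A) ∧
    ∫ t in Ioi A, (t ^ 2 + s * x) / ((t ^ 2 - s ^ 2) * (t ^ 2 - x ^ 2)) =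
      2 * ((field A s - field A x) / (s - x)) := by
  have hsx' : s - x ≠ 0 := sub_ne_zero.2 hsx
  let F : ℝ → ℝ := fun t => (1 / 2) * ((Real.log (t - s) - Real.log (t + s)) -
    (Real.log (t - x) - Real.log (t + x))) / (s - x)
  have hder : ∀ t ∈ Ici A,
      HasDerivAt F ((t ^ 2 + s * x) / ((t ^ 2 - s ^ 2) * (t ^ 2 - x ^ 2))) t := by
    intro t ht
    have hAt : A ≤ t := ht
    have e1 : 0 < t - s := by linarith [hs.2]
    have e2 : 0 < t + s := by linarith [hs.1]
    have e3 : 0 < t - x := by linarith [hx.2]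
    have e4 : 0 < t + x := by linarith [hx.1]
    have h := ((((((hasDerivAt_id t).sub_const s).log e1.ne').sub
      (((hasDerivAt_id t).add_const s).log e2.ne')).sub
      ((((hasDerivAt_id t).sub_const x).log e3.ne').sub
      (((hasDerivAt_id t).add_const x).log e4.ne'))).const_mul (1 / 2)).div_const (s - x)
    refine h.congr_deriv ?_
    rw [show t ^ 2 - s ^ 2 = (t - s) * (t + s) by ring,
      show t ^ 2 - x ^ 2 = (t - x) * (t + x) by ring]
    simp only [id]
    field_simp
    ring
  have hpos : ∀ t ∈ Ioi A, 0 ≤ (t ^ 2 + s * x) / ((t ^ 2 - s ^ 2) * (t ^ 2 - x ^ 2)) := by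
    intro t ht
    have hAt : A < t := ht
    have hs' : |s| < t := (abs_lt.2 hs).trans hAt
    have hx' : |x| < t := (abs_lt.2 hx).trans hAt
    have e1 : 0 < t ^ 2 - s ^ 2 := sub_pos.2 (sq_lt_sq' (by linarith [neg_abs_le s]) (by linarith [le_abs_self s]))
    have e2 : 0 < t ^ 2 - x ^ 2 := sub_pos.2 (sq_lt_sq' (by linarith [neg_abs_le x]) (by linarith [le_abs_self x]))
    have e3 : 0 ≤ t ^ 2 + s * x := by nlinarith [sq_nonneg (s + x)]
    positivity
  have hlim : Tendsto F atTop (𝓝 0) := by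
    have := (((tendsto_log_sub_div_add_atTop s).sub
      (tendsto_log_sub_div_add_atTop x)).const_mul (1 / 2)).div_const (s - x)
    simpa [F] using this
  refine ⟨integrableOn_Ioi_deriv_of_nonneg' hder hpos hlim, ?_⟩
  rw [integral_Ioi_of_hasDerivAt_of_nonneg' hder hpos hlim]
  simp only [F, field]
  ring

/-- Fubini for a nonnegative integrand: integrating in s first leaves an elementary integral over t
> A, which also proves integrability. -/
theorem integrableOn_and_integral_field_slope_arcsine {A a x : ℝ} (ha : 0 < a) (hA : a ≤ A)
    (hx : x ∈ Ioo (-a) a) :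
    IntegrableOn (fun s => (field A s - field A x) / (s - x) / √(a ^ 2 - s ^ 2)) (Ioo (-a) a) ∧
    ∫ s in Ioo (-a) a, (field A s - field A x) / (s - x) / √(a ^ 2 - s ^ 2) =
      Real.pi / 2 * ((Real.pi / 2 - Real.arctan (√(A ^ 2 - a ^ 2) / √(a ^ 2 - x ^ 2))) /
        √(a ^ 2 - x ^ 2)) := by
  let f : ℝ × ℝ → ℝ := fun p => (p.2 ^ 2 + p.1 * x) / ((p.2 ^ 2 - p.1 ^ 2) * (p.2 ^ 2 - x ^ 2)) /
      √(a ^ 2 - p.1 ^ 2)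
  have hmeas : Measurable f := by fun_prop
  have hnn : ∀ s ∈ Ioo (-a) a, ∀ t ∈ Ioi A, 0 ≤ f (s, t) := by
    intro s hs t ht
    have hAt : a < t := hA.trans_lt ht
    have e1 : 0 < t ^ 2 - s ^ 2 := by nlinarith [sq_sub_sq_pos hs]
    have e2 : 0 < t ^ 2 - x ^ 2 := by nlinarith [sq_sub_sq_pos hx]
    have e3 : 0 ≤ t ^ 2 + s * x := by nlinarith [sq_nonneg (s + x)]
    simp only [f]
    positivity
  obtain ⟨i1, i2⟩ := integrableOn_and_integral_Ioi_resolvent ha hA hx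
  have hint : Integrable f ((volume.restrict (Ioo (-a) a)).prod (volume.restrict (Ioi A))) := by
    rw [integrable_prod_iff' hmeas.aestronglyMeasurable]
    constructor
    · filter_upwards [ae_restrict_mem measurableSet_Ioi] with t ht
      exact (integrableOn_and_integral_arcsine_resolvent ha (hA.trans_lt ht) hx).1
    · refine Integrable.congr (i1.const_mul Real.pi) ?_
      filter_upwards [ae_restrict_mem measurableSet_Ioi] with t ht
      rw [← (integrableOn_and_integral_arcsine_resolvent ha (hA.trans_lt ht) hx).2]
      refine setIntegral_congr_fun measurableSet_Ioo fun s hs => ?_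
      exact (Real.norm_of_nonneg (hnn s hs t ht)).symm
  have hae : ∀ᵐ s ∂(volume.restrict (Ioo (-a) a)), ∫ t in Ioi A, f (s, t) =
      2 * ((field A s - field A x) / (s - x) / √(a ^ 2 - s ^ 2)) := by
    have hne : ∀ᵐ s ∂(volume.restrict (Ioo (-a) a)), s ≠ x :=
      ae_restrict_of_ae (Measure.ae_ne volume x)
    filter_upwards [ae_restrict_mem measurableSet_Ioo, hne] with s hs hsx
    have hmono : Ioo (-a) a ⊆ Ioo (-A) A := Ioo_subset_Ioo (by linarith) hA
    simp only [f]
    rw [integral_div, (integrableOn_and_integral_field_slope (hmono hs) (hmono hx) hsx).2]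
    ring
  have hI := hint.integral_prod_left.congr hae
  refine ⟨by simpa [IntegrableOn, ← mul_assoc] using hI.const_mul (1 / 2), ?_⟩
  have h1 := integral_integral_swap (f := fun s t => f (s, t)) hint
  rw [integral_congr_ae hae, integral_const_mul] at h1
  have h2 : ∫ t in Ioi A, ∫ s in Ioo (-a) a, f (s, t) =
      ∫ t in Ioi A, Real.pi * (t / ((t ^ 2 - x ^ 2) * √(t ^ 2 - a ^ 2))) :=
    setIntegral_congr_fun measurableSet_Ioi fun t ht =>
      (integrableOn_and_integral_arcsine_resolvent ha (hA.trans_lt ht) hx).2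
  rw [h2, integral_const_mul, i2] at h1
  linarith

/-! ### Closed form of the density and its elementary properties -/

theorem measurableSet_truncated (a x ε : ℝ) : MeasurableSet (LogEnergy.truncated a x ε) := by
  have h : Measurable fun s : ℝ => |s - x| := by fun_prop
  exact measurableSet_Ioo.inter (measurableSet_lt measurable_const h)

theorem LogEnergy.HasPV.add_integrableOn {a x L : ℝ} {f g : ℝ → ℝ} (hf : LogEnergy.HasPV a x f L)
    (hg : IntegrableOn g (Ioo (-a) a)) :
    LogEnergy.HasPV a x (fun s => f s + g s) (L + ∫ s in Ioo (-a) a, g s) := by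
  have hsub : ∀ ε, LogEnergy.truncated a x ε ⊆ Ioo (-a) a := fun ε s hs => hs.1
  have hms := measurableSet_truncated a x
  refine ⟨fun ε hε => (hf.1 ε hε).add (hg.mono_set (hsub ε)), ?_⟩
  have hlim : Tendsto (fun ε : ℝ => ∫ s in LogEnergy.truncated a x ε, g s) (𝓝[>] 0)
      (𝓝 (∫ s in Ioo (-a) a, g s)) := by
    have h1 : ∀ ε, ∫ s in LogEnergy.truncated a x ε, g s =
        ∫ s in Ioo (-a) a, (LogEnergy.truncated a x ε).indicator g s := fun ε => by
      rw [setIntegral_indicator (hms ε), inter_eq_right.2 (hsub ε)]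
    simp only [h1]
    refine tendsto_integral_filter_of_dominated_convergence (fun s => ‖g s‖)
      (Eventually.of_forall fun ε => hg.aestronglyMeasurable.indicator (hms ε))
      (Eventually.of_forall fun ε => Eventually.of_forall fun s => norm_indicator_le_norm_self _ _)
      hg.norm ?_
    filter_upwards [ae_restrict_mem measurableSet_Ioo,
      ae_restrict_of_ae (Measure.ae_ne volume x)] with s hs hsx
    refine tendsto_const_nhds.congr' ?_
    filter_upwards [Ioo_mem_nhdsGT (abs_pos.2 (sub_ne_zero.2 hsx))] with ε hε
    exact (indicator_of_mem (show s ∈ LogEnergy.truncated a x ε from ⟨hs, hε.2⟩) g).symm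
  refine (hf.2.add hlim).congr' ?_
  filter_upwards [self_mem_nhdsWithin] with ε hε
  exact (integral_add (hf.1 ε hε) (hg.mono_set (hsub ε))).symm

theorem LogEnergy.HasPV.const_mul {a x L : ℝ} {f : ℝ → ℝ} (hf : LogEnergy.HasPV a x f L) (k : ℝ) :
    LogEnergy.HasPV a x (fun s => k * f s) (k * L) :=
  ⟨fun ε hε => (hf.1 ε hε).const_mul k, by simpa only [integral_const_mul] using hf.2.const_mul k⟩

theorem LogEnergy.HasPV.pv_eq {a x L : ℝ} {f : ℝ → ℝ} (hf : LogEnergy.HasPV a x f L) :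
    LogEnergy.pv a x f = L := hf.2.limUnder_eq

/-- Splitting off `field (c / 2) x` times the Cauchy kernel, of principal value zero, leaves an
absolutely convergent integral. -/
theorem hasPV_kernel {c a x : ℝ} (ha : 0 < a) (hA : a ≤ c / 2) (hx : x ∈ Ioo (-a) a) :
    LogEnergy.HasPV a x (LogEnergy.kernel c a x) (Real.pi / 2 * ((Real.pi / 2 -
      Real.arctan (√((c / 2) ^ 2 - a ^ 2) / √(a ^ 2 - x ^ 2))) / √(a ^ 2 - x ^ 2))) := by
  obtain ⟨h1, h2⟩ := integrableOn_and_integral_field_slope_arcsine ha hA hx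
  have h3 := ((hasPV_cauchy hx).const_mul (field (c / 2) x)).add_integrableOn h1
  rw [h2, mul_zero, zero_add] at h3
  have key : ∀ s, s ≠ x → LogEnergy.kernel c a x s =
      field (c / 2) x * (1 / (√(a ^ 2 - s ^ 2) * (s - x))) +
      (field (c / 2) s - field (c / 2) x) / (s - x) / √(a ^ 2 - s ^ 2) := by
    intro s hs
    simp only [LogEnergy.kernel, field]
    have : s - x ≠ 0 := sub_ne_zero.2 hs
    rw [div_div, mul_comm (s - x)]
    ring
  have hms := measurableSet_truncated a x
  have hne : ∀ ε, 0 < ε → ∀ s ∈ LogEnergy.truncated a x ε, s ≠ x := by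
    rintro ε hε s hs rfl
    have := hs.2
    simp at this
    linarith
  refine ⟨fun ε hε => (h3.1 ε hε).congr_fun (fun s hs => (key s (hne ε hε s hs)).symm) (hms ε),
    h3.2.congr' ?_⟩
  filter_upwards [self_mem_nhdsWithin] with ε hε
  exact setIntegral_congr_fun (hms ε) fun s hs => (key s (hne ε hε s hs)).symm

/-- The closed form of the equilibrium density. -/
noncomputable def equilibriumDensity (A a x : ℝ) : ℝ :=
  (Ioo (-a) a).indicator (fun x => 1 / (2 * Real.pi) *
    (Real.pi / 2 - Real.arctan (√(A ^ 2 - a ^ 2) / √(a ^ 2 - x ^ 2)))) x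

theorem density_eq_equilibriumDensity {c a : ℝ} (ha : 0 < a) (hA : a ≤ c / 2) :
    LogEnergy.density c a = equilibriumDensity (c / 2) a := by
  funext x
  by_cases hx : x ∈ Ioo (-a) a
  · have hr := sqrt_sq_sub_sq_pos hx
    rw [LogEnergy.density, (hasPV_kernel ha hA hx).pv_eq, equilibriumDensity, indicator_of_mem hx]
    field_simp
  -- Outside the interval `pv` may be a meaningless default value; the vanishing square root removes
  -- it.
  · rw [equilibriumDensity, indicator_of_notMem hx, LogEnergy.density, Real.sqrt_eq_zero'.2]
    · simp
    · have : a ≤ |x| := by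
        by_contra h
        exact hx (abs_lt.1 (not_le.1 h))
      rw [← sq_abs x]
      nlinarith

theorem equilibriumDensity_pos {A a x : ℝ} (hx : x ∈ Ioo (-a) a) :
    0 < equilibriumDensity A a x := by
  rw [equilibriumDensity, indicator_of_mem hx]
  have := Real.pi_pos
  have h := Real.arctan_lt_pi_div_two (√(A ^ 2 - a ^ 2) / √(a ^ 2 - x ^ 2))
  exact mul_pos (by positivity) (by linarith)

theorem equilibriumDensity_eq_zero {A a x : ℝ} (hx : x ∉ Ioo (-a) a) :
    equilibriumDensity A a x = 0 := by
  rw [equilibriumDensity, indicator_of_notMem hx]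

theorem equilibriumDensity_nonneg (A a x : ℝ) : 0 ≤ equilibriumDensity A a x := by
  by_cases hx : x ∈ Ioo (-a) a
  · exact (equilibriumDensity_pos hx).le
  · exact (equilibriumDensity_eq_zero hx).ge

theorem equilibriumDensity_le (A a x : ℝ) : equilibriumDensity A a x ≤ 1 / 4 := by
  have hp := Real.pi_pos
  by_cases hx : x ∈ Ioo (-a) a
  · rw [equilibriumDensity, indicator_of_mem hx]
    have h := Real.arctan_nonneg.2
      (show 0 ≤ √(A ^ 2 - a ^ 2) / √(a ^ 2 - x ^ 2) by positivity)
    rw [one_div, inv_mul_le_iff₀ (by positivity)]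
    linarith
  · rw [equilibriumDensity_eq_zero hx]
    norm_num

theorem measurable_equilibriumDensity (A a : ℝ) : Measurable (equilibriumDensity A a) := by
  unfold equilibriumDensity
  refine Measurable.indicator ?_ measurableSet_Ioo
  have := Real.measurable_arctan
  fun_prop

theorem norm_equilibriumDensity_le (A a x : ℝ) : ‖equilibriumDensity A a x‖ ≤ 1 / 4 := by
  rw [Real.norm_of_nonneg (equilibriumDensity_nonneg A a x)]
  exact equilibriumDensity_le A a x

theorem integrable_equilibriumDensity (A a : ℝ) : Integrable (equilibriumDensity A a) := by
  have h : IntegrableOn (equilibriumDensity A a) (Ioo (-a) a) :=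
    Measure.integrableOn_of_bounded (M := 1 / 4) (by simp)
      (measurable_equilibriumDensity A a).aestronglyMeasurable
      (Eventually.of_forall (norm_equilibriumDensity_le A a))
  exact (integrableOn_iff_integrable_of_support_subset fun x hx => by
    by_contra h'; exact hx (equilibriumDensity_eq_zero h')).1 h

theorem tsupport_equilibriumDensity {A a : ℝ} (ha : 0 < a) :
    tsupport (equilibriumDensity A a) = Icc (-a) a := by
  have : Function.support (equilibriumDensity A a) = Ioo (-a) a := by
    ext x
    rw [Function.mem_support]
    refine ⟨fun h => by_contra fun h' => h (equilibriumDensity_eq_zero h'),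
      fun h => (equilibriumDensity_pos h).ne'⟩
  rw [tsupport, this, closure_Ioo (by linarith)]

/-! ### The equilibrium density as a mixture of arcsine laws -/

/-- The density of the mixing measure that writes the equilibrium density as a superposition of
arcsine distributions on the intervals `[-b, b]`. -/
noncomputable def mixingDensity (A b : ℝ) : ℝ := b / (2 * √(A ^ 2 - b ^ 2))

/-- The density of the arcsine distribution on `[-b, b]`. -/
noncomputable def arcsineDensity (b x : ℝ) : ℝ :=
  (Ioo (-b) b).indicator (fun x => 1 / (Real.pi * √(b ^ 2 - x ^ 2))) x

theorem mixingDensity_nonneg {A b : ℝ} (hb : 0 ≤ b) : 0 ≤ mixingDensity A b := by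
  unfold mixingDensity; positivity

theorem arcsineDensity_nonneg (b x : ℝ) : 0 ≤ arcsineDensity b x :=
  indicator_nonneg (fun x _ => by have := Real.pi_pos; positivity) x

theorem measurable_mixingDensity (A : ℝ) : Measurable (mixingDensity A) := by
  unfold mixingDensity; fun_prop

theorem measurable_arcsineDensity : Measurable fun p : ℝ × ℝ => arcsineDensity p.1 p.2 := by
  have : (fun p : ℝ × ℝ => arcsineDensity p.1 p.2) =
      {p : ℝ × ℝ | -p.1 < p.2 ∧ p.2 < p.1}.indicator
        fun p => 1 / (Real.pi * √(p.1 ^ 2 - p.2 ^ 2)) := by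
    funext p
    simp only [arcsineDensity, indicator, mem_Ioo, mem_ofPred_eq]
  rw [this]
  refine Measurable.indicator (by fun_prop) ?_
  exact (measurableSet_lt measurable_fst.neg measurable_snd).inter
    (measurableSet_lt measurable_snd measurable_fst)

/-- For fixed x, the integrand is the derivative of the closed form with respect to the endpoint b,
and the closed form tends to 0 as b decreases to |x|, where the arctangent tends to π/2. -/
theorem integrableOn_and_integral_mixture {A a x : ℝ} (hA : a ≤ A) (hx : x ∈ Ioo (-a) a) :
    IntegrableOn (fun b => mixingDensity A b * (1 / (Real.pi * √(b ^ 2 - x ^ 2)))) (Ioo |x| a) ∧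
    ∫ b in Ioo |x| a, mixingDensity A b * (1 / (Real.pi * √(b ^ 2 - x ^ 2))) =
      equilibriumDensity A a x := by
  have hxa : |x| < a := abs_lt.2 hx
  have hr := sqrt_sq_sub_sq_pos hx
  have hpi := Real.pi_pos
  let F : ℝ → ℝ := fun b => -(1 / (2 * Real.pi) *
    Real.arctan (√(A ^ 2 - b ^ 2) / √(b ^ 2 - x ^ 2)))
  have hder : ∀ b ∈ Ioo |x| a,
      HasDerivAt F (mixingDensity A b * (1 / (Real.pi * √(b ^ 2 - x ^ 2)))) b := by
    intro b hb
    have hbx : x ^ 2 < b ^ 2 := by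
      rw [← sq_abs x]; nlinarith [abs_nonneg x, hb.1]
    have hb0 : 0 < b := (abs_nonneg x).trans_lt hb.1
    have hbA : b ∈ Ioo (-A) A := ⟨by linarith [hb.2], by linarith [hb.2]⟩
    have hq := Real.sqrt_pos.2 (sub_pos.2 hbx)
    have hq2 : √(b ^ 2 - x ^ 2) ^ 2 = b ^ 2 - x ^ 2 := Real.sq_sqrt (sub_pos.2 hbx).le
    have hp := sqrt_sq_sub_sq_pos hbA
    have hp2 : √(A ^ 2 - b ^ 2) ^ 2 = A ^ 2 - b ^ 2 := Real.sq_sqrt (sq_sub_sq_pos hbA).le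
    have hd : HasDerivAt (fun b => √(b ^ 2 - x ^ 2)) (b / √(b ^ 2 - x ^ 2)) b := by
      have := hasDerivAt_sqrt_sq_sub_sq' (abs_nonneg x) hb.1
      simpa only [sq_abs] using this
    have h1 := ((((hasDerivAt_sqrt_sq_sub_sq hbA).div hd hq.ne').arctan).const_mul
      (1 / (2 * Real.pi))).neg
    refine h1.congr_deriv ?_
    clear h1 hd
    simp only [Pi.div_apply, mixingDensity]
    generalize √(b ^ 2 - x ^ 2) = q at *
    generalize √(A ^ 2 - b ^ 2) = p at *
    have h3 : 1 + (p / q) ^ 2 = (p ^ 2 + q ^ 2) / q ^ 2 := by field_simp; ring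
    rw [h3]
    field_simp
    ring
  have hpos : ∀ b ∈ Ioo |x| a, 0 ≤ mixingDensity A b * (1 / (Real.pi * √(b ^ 2 - x ^ 2))) := by
    intro b hb
    have := mixingDensity_nonneg (A := A) ((abs_nonneg x).trans hb.1.le)
    positivity
  have hright : Tendsto F (𝓝[<] a)
      (𝓝 (-(1 / (2 * Real.pi) * Real.arctan (√(A ^ 2 - a ^ 2) / √(a ^ 2 - x ^ 2))))) := by
    have : ContinuousAt F a := by
      have := hr.ne'
      have := Real.continuous_arctan
      fun_prop (disch := assumption)
    exact this.tendsto.mono_left nhdsWithin_le_nhds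
  have hleft : Tendsto F (𝓝[>] |x|) (𝓝 (-(1 / (2 * Real.pi) * (Real.pi / 2)))) := by
    refine (Tendsto.const_mul _ ?_).neg
    refine (Real.tendsto_arctan_atTop.mono_right nhdsWithin_le_nhds).comp ?_
    have h1 : Tendsto (fun b : ℝ => √(A ^ 2 - b ^ 2)) (𝓝[>] |x|) (𝓝 √(A ^ 2 - |x| ^ 2)) :=
      (by fun_prop : Continuous fun b : ℝ => √(A ^ 2 - b ^ 2)).continuousWithinAt
    have h2 : Tendsto (fun b : ℝ => √(b ^ 2 - x ^ 2)) (𝓝[>] |x|) (𝓝[>] 0) := by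
      refine tendsto_nhdsWithin_iff.2 ⟨?_, ?_⟩
      · have : Continuous fun b : ℝ => √(b ^ 2 - x ^ 2) := by fun_prop
        simpa using (this.tendsto |x|).mono_left nhdsWithin_le_nhds
      · filter_upwards [self_mem_nhdsWithin] with b hb
        refine Real.sqrt_pos.2 ?_
        have : |x| < b := hb
        rw [← sq_abs x]; nlinarith [abs_nonneg x]
    have h3 : 0 < √(A ^ 2 - |x| ^ 2) := by
      refine Real.sqrt_pos.2 ?_
      nlinarith [abs_nonneg x]
    simpa [div_eq_mul_inv, Function.comp_def] using
      h1.pos_mul_atTop h3 (tendsto_inv_nhdsGT_zero.comp h2)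
  refine ⟨integrableOn_Ioo_deriv_of_nonneg_of_tendsto hxa hder hpos hleft hright, ?_⟩
  rw [integral_Ioo_eq_sub_of_hasDerivAt_of_nonneg_of_tendsto hxa hder hpos hleft hright,
    equilibriumDensity, indicator_of_mem hx]
  ring

theorem arcsineDensity_slice (x : ℝ) (b : ℝ) :
    arcsineDensity b x = (Ioi |x|).indicator (fun b => 1 / (Real.pi * √(b ^ 2 - x ^ 2))) b := by
  simp only [arcsineDensity, indicator, ← abs_lt, mem_Ioi, mem_Ioo]

theorem integrableOn_and_integral_mixture_arcsine {A a : ℝ} (hA : a ≤ A) (x : ℝ) :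
    IntegrableOn (fun b => mixingDensity A b * arcsineDensity b x) (Ioo 0 a) ∧
    ∫ b in Ioo 0 a, mixingDensity A b * arcsineDensity b x = equilibriumDensity A a x := by
  have h1 : (fun b => mixingDensity A b * arcsineDensity b x) = (Ioi |x|).indicator
      fun b => mixingDensity A b * (1 / (Real.pi * √(b ^ 2 - x ^ 2))) := by
    funext b
    rw [arcsineDensity_slice, indicator_mul_right (Ioi |x|) (mixingDensity A)]
  have h2 : Ioo 0 a ∩ Ioi |x| = Ioo |x| a := by
    ext b
    simp only [mem_inter_iff, mem_Ioo, mem_Ioi]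
    exact ⟨fun h => ⟨h.2, h.1.2⟩, fun h => ⟨⟨(abs_nonneg x).trans_lt h.1, h.2⟩, h.1⟩⟩
  have h2' : Ioi |x| ∩ Ioo 0 a = Ioo |x| a := by rw [inter_comm, h2]
  rw [h1, IntegrableOn, integrable_indicator_iff measurableSet_Ioi,
    setIntegral_indicator measurableSet_Ioi, IntegrableOn,
    Measure.restrict_restrict measurableSet_Ioi, h2, h2']
  by_cases hx : x ∈ Ioo (-a) a
  · exact integrableOn_and_integral_mixture hA hx
  · have : a ≤ |x| := not_lt.1 fun h => hx (abs_lt.1 h)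
    rw [Ioo_eq_empty (not_lt.2 this), equilibriumDensity_eq_zero hx]
    simp

/-- As weight and arcsine density are nonnegative, integrating the absolute value over b gives back
|ρφ|, so integrability of ρφ alone justifies Fubini. -/
theorem integral_equilibriumDensity_mul {A a : ℝ} (hA : a ≤ A) {φ : ℝ → ℝ} (hφm : Measurable φ)
    (hφ : Integrable (fun x => equilibriumDensity A a x * φ x)) :
    IntegrableOn (fun b => mixingDensity A b * ∫ x, arcsineDensity b x * φ x) (Ioo 0 a) ∧
    ∫ x, equilibriumDensity A a x * φ x =
      ∫ b in Ioo 0 a, mixingDensity A b * ∫ x, arcsineDensity b x * φ x := by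
  let f : ℝ × ℝ → ℝ := fun p => mixingDensity A p.1 * arcsineDensity p.1 p.2 * φ p.2
  have hf : Measurable f :=
    (((measurable_mixingDensity A).comp measurable_fst).mul measurable_arcsineDensity).mul
      (hφm.comp measurable_snd)
  have hint : Integrable f ((volume.restrict (Ioo 0 a)).prod volume) := by
    rw [integrable_prod_iff' hf.aestronglyMeasurable]
    refine ⟨Eventually.of_forall fun x =>
      (integrableOn_and_integral_mixture_arcsine hA x).1.mul_const (φ x), ?_⟩
    refine hφ.norm.congr (Eventually.of_forall fun x => ?_)
    simp only [f, norm_mul]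
    rw [integral_mul_const, Real.norm_of_nonneg (equilibriumDensity_nonneg A a x),
      ← (integrableOn_and_integral_mixture_arcsine hA x).2]
    congr 1
    refine setIntegral_congr_fun measurableSet_Ioo fun b hb => ?_
    simp only [Real.norm_of_nonneg (mixingDensity_nonneg hb.1.le),
      Real.norm_of_nonneg (arcsineDensity_nonneg b x)]
  have hin : ∀ b, ∫ x, f (b, x) = mixingDensity A b * ∫ x, arcsineDensity b x * φ x := fun b => by
    simp only [f, mul_assoc, integral_const_mul]
  refine ⟨hint.integral_prod_left.congr (Eventually.of_forall hin), ?_⟩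
  have h1 := integral_integral_swap (f := fun b x => f (b, x)) hint
  simp only [hin] at h1
  rw [h1]
  refine integral_congr_ae (Eventually.of_forall fun x => ?_)
  simp only [f]
  rw [integral_mul_const, (integrableOn_and_integral_mixture_arcsine hA x).2]

theorem integrableOn_and_integral_mixingDensity {A a : ℝ} (ha : 0 < a) (hA : a ≤ A) :
    IntegrableOn (mixingDensity A) (Ioo 0 a) ∧
    ∫ b in Ioo 0 a, mixingDensity A b = (A - √(A ^ 2 - a ^ 2)) / 2 := by
  let F : ℝ → ℝ := fun b => -√(A ^ 2 - b ^ 2) / 2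
  have hder : ∀ b ∈ Ioo 0 a, HasDerivAt F (mixingDensity A b) b := by
    intro b hb
    refine ((hasDerivAt_sqrt_sq_sub_sq (a := A) ⟨by linarith [hb.1, hb.2],
      by linarith [hb.2]⟩).neg.div_const 2).congr_deriv ?_
    rw [mixingDensity]
    ring
  have hpos : ∀ b ∈ Ioo 0 a, 0 ≤ mixingDensity A b := fun b hb => mixingDensity_nonneg hb.1.le
  have hc : Continuous F := by fun_prop
  have h0 : Tendsto F (𝓝[>] 0) (𝓝 (F 0)) := hc.continuousWithinAt
  have h1 : Tendsto F (𝓝[<] a) (𝓝 (F a)) := hc.continuousWithinAt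
  refine ⟨integrableOn_Ioo_deriv_of_nonneg_of_tendsto ha hder hpos h0 h1, ?_⟩
  rw [integral_Ioo_eq_sub_of_hasDerivAt_of_nonneg_of_tendsto ha hder hpos h0 h1]
  simp only [F]
  rw [show A ^ 2 - 0 ^ 2 = A ^ 2 by ring, Real.sqrt_sq (by linarith)]
  ring

/-! ### The logarithmic potential of an arcsine law -/

/-- The substitution x = b cos θ on (0, π), doubled by symmetry to a full turn so that circle
averages apply. -/
theorem integral_arcsineDensity_mul {b : ℝ} (hb : 0 < b) (φ : ℝ → ℝ) :
    ∫ x, arcsineDensity b x * φ x =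
      (2 * Real.pi)⁻¹ * ∫ θ in (0)..(2 * Real.pi), φ (b * Real.cos θ) := by
  have hpi := Real.pi_pos
  have h1 : ∫ x, arcsineDensity b x * φ x =
      ∫ x in Ioo (-b) b, 1 / (Real.pi * √(b ^ 2 - x ^ 2)) * φ x := by
    rw [← integral_indicator measurableSet_Ioo]
    refine integral_congr_ae (Eventually.of_forall fun x => ?_)
    simp only [arcsineDensity]
    rw [indicator_mul_left (Ioo (-b) b) _ φ]
  have himage : (fun θ => b * Real.cos θ) '' Ioo 0 Real.pi = Ioo (-b) b := by
    ext y
    constructor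
    · rintro ⟨θ, hθ, rfl⟩
      have hs := Real.sin_pos_of_pos_of_lt_pi hθ.1 hθ.2
      have := Real.sin_sq_add_cos_sq θ
      have h := abs_lt.1 ((sq_lt_one_iff_abs_lt_one (Real.cos θ)).1 (by nlinarith))
      constructor <;> simp only <;> nlinarith [h.1, h.2]
    · intro hy
      have h1 : -1 < y / b := by rw [lt_div_iff₀ hb]; linarith [hy.1]
      have h2 : y / b < 1 := by rw [div_lt_iff₀ hb]; linarith [hy.2]
      refine ⟨Real.arccos (y / b), ⟨Real.arccos_pos.2 h2, ?_⟩, ?_⟩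
      · refine lt_of_le_of_ne (Real.arccos_le_pi _) fun h => ?_
        rw [Real.arccos_eq_pi] at h
        linarith
      · simp only [Real.cos_arccos h1.le h2.le]
        field_simp
  have hinj : InjOn (fun θ => b * Real.cos θ) (Ioo 0 Real.pi) := fun θ hθ η hη h =>
    Real.injOn_cos (Ioo_subset_Icc_self hθ) (Ioo_subset_Icc_self hη)
      (mul_left_cancel₀ hb.ne' h)
  have h2 := integral_image_eq_integral_abs_deriv_smul (s := Ioo 0 Real.pi) measurableSet_Ioo
    (f := fun θ => b * Real.cos θ) (f' := fun θ => b * -Real.sin θ)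
    (fun θ _ => ((Real.hasDerivAt_cos θ).const_mul b).hasDerivWithinAt) hinj
    (fun x => 1 / (Real.pi * √(b ^ 2 - x ^ 2)) * φ x)
  rw [himage] at h2
  have h3 : ∫ x in Ioo (-b) b, 1 / (Real.pi * √(b ^ 2 - x ^ 2)) * φ x =
      Real.pi⁻¹ * ∫ θ in (0)..Real.pi, φ (b * Real.cos θ) := by
    rw [h2, intervalIntegral.integral_of_le hpi.le, integral_Ioc_eq_integral_Ioo,
      ← integral_const_mul]
    refine setIntegral_congr_fun measurableSet_Ioo fun θ hθ => ?_
    have hs := Real.sin_pos_of_pos_of_lt_pi hθ.1 hθ.2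
    have hsq : b ^ 2 - (b * Real.cos θ) ^ 2 = (b * Real.sin θ) ^ 2 := by
      rw [mul_pow, mul_pow, Real.sin_sq]; ring
    simp only [smul_eq_mul]
    rw [hsq, Real.sqrt_sq (by positivity), mul_neg, abs_neg, abs_of_pos (by positivity)]
    field_simp
  have h4 : ∫ θ in (0)..(2 * Real.pi), φ (b * Real.cos θ) =
      2 * ∫ θ in (0)..Real.pi, φ (b * Real.cos θ) := by
    have hsymm : ∀ θ, φ (b * Real.cos (2 * Real.pi - θ)) = φ (b * Real.cos θ) := fun θ => by
      rw [Real.cos_two_pi_sub]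
    by_cases hi : IntervalIntegrable (fun θ => φ (b * Real.cos θ)) volume 0 Real.pi
    · have hi2 : IntervalIntegrable (fun θ => φ (b * Real.cos θ)) volume Real.pi
          (2 * Real.pi) := by
        have := (hi.comp_sub_left (2 * Real.pi)).symm
        simp only [hsymm] at this
        convert this using 1 <;> ring
      rw [← intervalIntegral.integral_add_adjacent_intervals hi hi2]
      have := intervalIntegral.integral_comp_sub_left (fun θ => φ (b * Real.cos θ))
        (a := 0) (b := Real.pi) (2 * Real.pi)
      simp only [hsymm] at this
      rw [show 2 * Real.pi - Real.pi = Real.pi by ring, sub_zero] at this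
      rw [← this]
      ring
    -- Without integrability both integrals take the default value 0, so no hypothesis on φ is
    -- needed.
    · have hi2 : ¬IntervalIntegrable (fun θ => φ (b * Real.cos θ)) volume 0 (2 * Real.pi) :=
        fun h => hi (h.mono_set (by
          rw [uIcc_of_le hpi.le, uIcc_of_le (by positivity)]
          exact Icc_subset_Icc_right (by linarith)))
      rw [intervalIntegral.integral_undef hi, intervalIntegral.integral_undef hi2, mul_zero]
  rw [h1, h3, h4]
  field_simp

theorem ne_mem_codiscreteWithin (a : ℂ) (S : Set ℂ) : {z | z ≠ a} ∈ codiscreteWithin S := by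
  apply codiscreteWithin_iff_locallyFiniteComplementWithin.2
  intro z hz
  refine ⟨univ, univ_mem, ?_⟩
  apply Set.Subsingleton.finite
  intro z₁ hz₁ z₂ hz₂
  have h1 : z₁ = a := not_not.1 hz₁.2.2
  have h2 : z₂ = a := not_not.1 hz₂.2.2
  rw [h1, h2]

/-- Joukowski map: for z = exp(iθ), x - b cos θ = -(b/2)(z-w)(z-w⁻¹)/z, and the average of log‖z-w‖
over the unit circle is log⁺‖w‖. A complex w covers |x| ≤ b as well, with w on the circle. -/
theorem average_log_sub_mul_cos {b x : ℝ} (hb : 0 < b) {w : ℂ} (hw : w ≠ 0)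
    (hx : (b / 2 : ℂ) * (w + w⁻¹) = x) :
    (2 * Real.pi)⁻¹ * ∫ θ in (0)..(2 * Real.pi), Real.log (x - b * Real.cos θ) =
      Real.log (b / 2) + (Real.posLog ‖w‖ + Real.posLog ‖w⁻¹‖) := by
  have hb2 : b / 2 ≠ 0 := by positivity
  have h1 : (2 * Real.pi)⁻¹ * ∫ θ in (0)..(2 * Real.pi), Real.log (x - b * Real.cos θ) =
      Real.circleAverage (fun z => Real.log (b / 2 * (‖z - w‖ * ‖z - w⁻¹‖))) 0 1 := by
    rw [Real.circleAverage_def, smul_eq_mul]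
    congr 1
    refine intervalIntegral.integral_congr fun θ _ => ?_
    simp only [circleMap, zero_add, Complex.ofReal_one, one_mul]
    rw [← Real.log_abs]
    congr 1
    set z := Complex.exp (θ * Complex.I) with hz
    have hz0 : z ≠ 0 := Complex.exp_ne_zero _
    have hzn : ‖z‖ = 1 := Complex.norm_exp_ofReal_mul_I θ
    have hcos : Complex.cos θ = (z + z⁻¹) / 2 := by
      rw [Complex.cos, hz, neg_mul, Complex.exp_neg]
    have key : ((x - b * Real.cos θ : ℝ) : ℂ) = -((b / 2 : ℝ) : ℂ) * ((z - w) * (z - w⁻¹)) / z := by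
      push_cast
      rw [hcos, ← hx]
      field_simp
      ring
    rw [← Real.norm_eq_abs, ← Complex.norm_real, key, norm_div, norm_mul, norm_neg, norm_mul, hzn,
      Complex.norm_real, Real.norm_of_nonneg (by positivity), div_one]
  have h2 : Real.circleAverage (fun z => Real.log (b / 2 * (‖z - w‖ * ‖z - w⁻¹‖))) 0 1 =
      Real.circleAverage (fun z => Real.log (b / 2) +
        (Real.log ‖z - w‖ + Real.log ‖z - w⁻¹‖)) 0 1 := by
    -- The logarithm of the product splits only off the zeros w and w⁻¹, which the average does not
    -- see.
    refine Real.circleAverage_congr_codiscreteWithin ?_ one_ne_zero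
    filter_upwards [ne_mem_codiscreteWithin w _, ne_mem_codiscreteWithin w⁻¹ _] with z h1 h2
    have h1' : ‖z - w‖ ≠ 0 := norm_ne_zero_iff.2 (sub_ne_zero.2 h1)
    have h2' : ‖z - w⁻¹‖ ≠ 0 := norm_ne_zero_iff.2 (sub_ne_zero.2 h2)
    rw [Real.log_mul hb2 (mul_ne_zero h1' h2'), Real.log_mul h1' h2']
  have hci : ∀ a : ℂ, CircleIntegrable (fun z => Real.log ‖z - a‖) 0 1 := fun a =>
    circleIntegrable_log_norm_sub_const 1
  have hci2 : CircleIntegrable (fun z => Real.log ‖z - w‖ + Real.log ‖z - w⁻¹‖) 0 1 :=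
    (hci w).add (hci w⁻¹)
  rw [h1, h2, Real.circleAverage_fun_add (circleIntegrable_const _ _ _) hci2,
    Real.circleAverage_const, Real.circleAverage_fun_add (hci w) (hci w⁻¹)]
  congr 2 <;> exact circleAverage_log_norm_sub_const_eq_posLog

/-- The inverse hyperbolic cosine of `x / b`, in logarithmic form. -/
noncomputable def logArcosh (b x : ℝ) : ℝ := Real.log ((x + √(x ^ 2 - b ^ 2)) / b)

theorem one_le_arcosh_arg {b x : ℝ} (hb : 0 < b) (hx : b < x) :
    1 ≤ (x + √(x ^ 2 - b ^ 2)) / b := by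
  rw [le_div_iff₀ hb]
  have := Real.sqrt_nonneg (x ^ 2 - b ^ 2)
  linarith

theorem logArcosh_nonneg {b x : ℝ} (hb : 0 < b) (hx : b < x) : 0 ≤ logArcosh b x :=
  Real.log_nonneg (one_le_arcosh_arg hb hx)

/-- For |x| > b the Joukowski preimage is real, ±W with W ≥ 1; for |x| ≤ b it is exp(i arccos(x/b)),
of modulus one. The indicator is taken in b because b is the later variable of integration. -/
theorem integral_arcsineDensity_mul_log {b : ℝ} (hb : 0 < b) (x : ℝ) :
    ∫ y, arcsineDensity b y * Real.log (x - y) =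
      Real.log (b / 2) + (Iio |x|).indicator (fun b => logArcosh b |x|) b := by
  rw [integral_arcsineDensity_mul hb fun y => Real.log (x - y)]
  rcases lt_or_ge b |x| with h | h
  · rw [indicator_of_mem (show b ∈ Iio |x| from h), logArcosh]
    have h1 := one_le_arcosh_arg hb h
    have h0 : 0 ≤ |x| ^ 2 - b ^ 2 := by nlinarith
    have hS : √(|x| ^ 2 - b ^ 2) ^ 2 = |x| ^ 2 - b ^ 2 := Real.sq_sqrt h0
    set W := (|x| + √(|x| ^ 2 - b ^ 2)) / b with hW
    have hW0 : 0 < W := by linarith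
    have hWinv : W⁻¹ = (|x| - √(|x| ^ 2 - b ^ 2)) / b := by
      refine inv_eq_of_mul_eq_one_right ?_
      rw [hW, div_mul_div_comm, div_eq_one_iff_eq (by positivity)]
      linear_combination -hS
    have hsum : b / 2 * (W + W⁻¹) = |x| := by
      rw [hWinv, hW]; field_simp; ring
    have hpl : Real.posLog W + Real.posLog W⁻¹ = Real.log W := by
      rw [Real.posLog_eq_log (by rw [abs_of_pos hW0]; exact h1),
        (Real.posLog_eq_zero_iff W⁻¹).2 (by rw [abs_of_pos (by positivity)]; exact inv_le_one_of_one_le₀ h1), add_zero]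
    have hsumC : (b / 2 : ℂ) * ((W : ℂ) + (W : ℂ)⁻¹) = (|x| : ℝ) := by
      rw [← hsum]; push_cast; ring
    have hWC : (W : ℂ) ≠ 0 := Complex.ofReal_ne_zero.2 hW0.ne'
    rcases abs_choice x with hx | hx
    · rw [average_log_sub_mul_cos hb hWC (by rw [hsumC, hx]), norm_inv, Complex.norm_real,
        Real.norm_of_nonneg hW0.le, hpl]
    · rw [average_log_sub_mul_cos hb (neg_ne_zero.2 hWC)
        (by rw [inv_neg, ← neg_add, mul_neg, hsumC, hx]; push_cast; ring), norm_inv, norm_neg,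
        Complex.norm_real, Real.norm_of_nonneg hW0.le, hpl]
  · rw [indicator_of_notMem (show b ∉ Iio |x| from not_lt.2 h)]
    have h1 : -1 ≤ x / b := by rw [le_div_iff₀ hb]; linarith [neg_abs_le x]
    have h2 : x / b ≤ 1 := by rw [div_le_iff₀ hb]; linarith [le_abs_self x]
    have hn : ‖Complex.exp (Real.arccos (x / b) * Complex.I)‖ = 1 :=
      Complex.norm_exp_ofReal_mul_I _
    have hx : (b / 2 : ℂ) * (Complex.exp (Real.arccos (x / b) * Complex.I) +
        (Complex.exp (Real.arccos (x / b) * Complex.I))⁻¹) = x := by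
      have hbc : (b : ℂ) ≠ 0 := Complex.ofReal_ne_zero.2 hb.ne'
      have hc : Complex.cos (Real.arccos (x / b)) = (x / b : ℝ) := by
        rw [← Complex.ofReal_cos, Real.cos_arccos h1 h2]
      rw [← Complex.exp_neg, ← neg_mul, ← Complex.two_cos, hc]
      push_cast
      field_simp
    rw [average_log_sub_mul_cos hb (Complex.exp_ne_zero _) hx, norm_inv, hn]
    simp

/-! ### Superposed arcsine potentials recover the external potential -/

theorem integrableOn_and_integral_inv_sqrt {b x : ℝ} (hb : 0 < b) (hx : b < x) :
    IntegrableOn (fun y => 1 / √(y ^ 2 - b ^ 2)) (Ioo b x) ∧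
    ∫ y in Ioo b x, 1 / √(y ^ 2 - b ^ 2) = logArcosh b x := by
  let F : ℝ → ℝ := fun y => Real.log (y + √(y ^ 2 - b ^ 2))
  have hder : ∀ y ∈ Ioo b x, HasDerivAt F (1 / √(y ^ 2 - b ^ 2)) y := by
    intro y hy
    have hq : 0 < √(y ^ 2 - b ^ 2) := Real.sqrt_pos.2 (by nlinarith [hy.1])
    have hy0 : 0 < y := hb.trans hy.1
    have h := ((hasDerivAt_id y).add (hasDerivAt_sqrt_sq_sub_sq' hb.le hy.1)).log
      (by simp only [Pi.add_apply, id]; positivity)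
    refine h.congr_deriv ?_
    simp only [Pi.add_apply, id]
    field_simp
    ring
  have hpos : ∀ y ∈ Ioo b x, 0 ≤ 1 / √(y ^ 2 - b ^ 2) := fun y hy => by positivity
  have hc : ∀ y, 0 < y → ContinuousAt F y := fun y hy =>
    ContinuousAt.log (by fun_prop) (by positivity)
  have h0 : Tendsto F (𝓝[>] b) (𝓝 (F b)) := (hc b hb).continuousWithinAt
  have h1 : Tendsto F (𝓝[<] x) (𝓝 (F x)) := (hc x (hb.trans hx)).continuousWithinAt
  refine ⟨integrableOn_Ioo_deriv_of_nonneg_of_tendsto hx hder hpos h0 h1, ?_⟩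
  rw [integral_Ioo_eq_sub_of_hasDerivAt_of_nonneg_of_tendsto hx hder hpos h0 h1]
  have : 0 < x + √(x ^ 2 - b ^ 2) := by have := hb.trans hx; positivity
  simp only [F, logArcosh]
  rw [Real.log_div this.ne' hb.ne', sub_self, Real.sqrt_zero, add_zero]

/-- The Abel equation that singles out the weight b/(2√(A²-b²)): this weight balances the external
field at every y. -/
theorem integrableOn_and_integral_mixing_inv_sqrt {A y : ℝ} (hy : y ∈ Ioo 0 A) :
    IntegrableOn (fun b => mixingDensity A b * (1 / √(y ^ 2 - b ^ 2))) (Ioo 0 y) ∧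
    ∫ b in Ioo 0 y, mixingDensity A b * (1 / √(y ^ 2 - b ^ 2)) = field A y := by
  have hA : 0 < A := hy.1.trans hy.2
  let F : ℝ → ℝ := fun b => -(1 / 2) * Real.log (√(A ^ 2 - b ^ 2) + √(y ^ 2 - b ^ 2))
  have hbA : ∀ b ∈ Icc 0 y, b ∈ Ioo (-A) A := fun b hb =>
    ⟨by linarith [hb.1], by linarith [hb.2, hy.2]⟩
  have hder : ∀ b ∈ Ioo 0 y, HasDerivAt F (mixingDensity A b * (1 / √(y ^ 2 - b ^ 2))) b := by
    intro b hb
    have hby : b ∈ Ioo (-y) y := ⟨by linarith [hb.1, hy.1], hb.2⟩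
    have hq := sqrt_sq_sub_sq_pos hby
    have hp := sqrt_sq_sub_sq_pos (hbA b (Ioo_subset_Icc_self hb))
    have h := (((hasDerivAt_sqrt_sq_sub_sq (hbA b (Ioo_subset_Icc_self hb))).add
      (hasDerivAt_sqrt_sq_sub_sq hby)).log (by simp only [Pi.add_apply]; positivity)).const_mul
      (-(1 / 2))
    refine h.congr_deriv ?_
    simp only [Pi.add_apply, mixingDensity]
    field_simp
    ring
  have hpos : ∀ b ∈ Ioo 0 y, 0 ≤ mixingDensity A b * (1 / √(y ^ 2 - b ^ 2)) := fun b hb => by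
    have := mixingDensity_nonneg (A := A) hb.1.le
    positivity
  have hc : ∀ b ∈ Icc 0 y, ContinuousAt F b := fun b hb => by
    have hp := sqrt_sq_sub_sq_pos (hbA b hb)
    exact (ContinuousAt.log (by fun_prop) (by positivity)).const_mul _
  have h0 : Tendsto F (𝓝[>] 0) (𝓝 (F 0)) := (hc 0 ⟨le_rfl, hy.1.le⟩).continuousWithinAt
  have h1 : Tendsto F (𝓝[<] y) (𝓝 (F y)) := (hc y ⟨hy.1.le, le_rfl⟩).continuousWithinAt
  refine ⟨integrableOn_Ioo_deriv_of_nonneg_of_tendsto hy.1 hder hpos h0 h1, ?_⟩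
  rw [integral_Ioo_eq_sub_of_hasDerivAt_of_nonneg_of_tendsto hy.1 hder hpos h0 h1]
  have e1 : 0 < A + y := by linarith [hy.1]
  have e2 : 0 < A - y := by linarith [hy.2]
  simp only [F, field]
  rw [sub_self, Real.sqrt_zero, add_zero, show A ^ 2 - 0 ^ 2 = A ^ 2 by ring,
    show y ^ 2 - 0 ^ 2 = y ^ 2 by ring, Real.sqrt_sq hA.le, Real.sqrt_sq hy.1.le,
    Real.log_sqrt (by nlinarith), show A ^ 2 - y ^ 2 = (A + y) * (A - y) by ring,
    Real.log_mul e1.ne' e2.ne']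
  ring

theorem continuous_V₀ (c : ℝ) : Continuous (LogEnergy.V₀ c) := by
  have h1 : Continuous fun u : ℝ => (c / 2 + u) * Real.log (c / 2 + u) :=
    Real.continuous_mul_log.comp (by fun_prop)
  have h2 : Continuous fun u : ℝ => (c / 2 - u) * Real.log (c / 2 - u) :=
    Real.continuous_mul_log.comp (by fun_prop)
  exact (h1.add h2).const_mul _

theorem integrableOn_and_integral_field {c x : ℝ} (hx0 : 0 < x) (hx : x ≤ c / 2) :
    IntegrableOn (field (c / 2)) (Ioo 0 x) ∧
    ∫ y in Ioo 0 x, field (c / 2) y = LogEnergy.V₀ c x - LogEnergy.V₀ c 0 := by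
  have hder : ∀ y ∈ Ioo 0 x, HasDerivAt (LogEnergy.V₀ c) (field (c / 2) y) y := by
    intro y hy
    have e1 : c / 2 + y ≠ 0 := by linarith [hy.1]
    have e2 : c / 2 - y ≠ 0 := by linarith [hy.2]
    have h1 := (Real.hasDerivAt_mul_log e1).comp y ((hasDerivAt_id y).const_add (c / 2))
    have h2 := (Real.hasDerivAt_mul_log e2).comp y ((hasDerivAt_id y).const_sub (c / 2))
    refine ((h1.add h2).const_mul (1 / 4)).congr_deriv ?_
    rw [field]
    ring
  have hpos : ∀ y ∈ Ioo 0 x, 0 ≤ field (c / 2) y := by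
    intro y hy
    have := Real.log_le_log (show 0 < c / 2 - y by linarith [hy.2])
      (show c / 2 - y ≤ c / 2 + y by linarith [hy.1])
    rw [field]
    linarith
  have hc := continuous_V₀ c
  have h0 : Tendsto (LogEnergy.V₀ c) (𝓝[>] 0) (𝓝 (LogEnergy.V₀ c 0)) := hc.continuousWithinAt
  have h1 : Tendsto (LogEnergy.V₀ c) (𝓝[<] x) (𝓝 (LogEnergy.V₀ c x)) := hc.continuousWithinAt
  exact ⟨integrableOn_Ioo_deriv_of_nonneg_of_tendsto hx0 hder hpos h0 h1,
    integral_Ioo_eq_sub_of_hasDerivAt_of_nonneg_of_tendsto hx0 hder hpos h0 h1⟩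

/-- Write arcosh(x/b) as the integral of 1/√(y²-b²) over b < y < x and exchange the integrals over
the triangle 0 < b < y < x; the inner integral is V₀'(y). -/
theorem integrableOn_and_integral_mixing_logArcosh {c x : ℝ} (hx0 : 0 < x) (hx : x ≤ c / 2) :
    IntegrableOn (fun b => mixingDensity (c / 2) b * logArcosh b x) (Ioo 0 x) ∧
    ∫ b in Ioo 0 x, mixingDensity (c / 2) b * logArcosh b x =
      LogEnergy.V₀ c x - LogEnergy.V₀ c 0 := by
  obtain ⟨i1, i2⟩ := integrableOn_and_integral_field hx0 hx
  let f : ℝ × ℝ → ℝ := {p : ℝ × ℝ | p.1 < p.2}.indicator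
    fun p => mixingDensity (c / 2) p.1 * (1 / √(p.2 ^ 2 - p.1 ^ 2))
  have hf : Measurable f := by
    refine Measurable.indicator ?_ (measurableSet_lt measurable_fst measurable_snd)
    exact ((measurable_mixingDensity _).comp measurable_fst).mul (by fun_prop)
  have hnn : ∀ b, 0 < b → ∀ y, 0 ≤ f (b, y) := fun b hb y => by
    refine indicator_apply_nonneg fun _ => ?_
    have := mixingDensity_nonneg (A := c / 2) hb.le
    positivity
  have hfy : ∀ y, (fun b => f (b, y)) = (Iio y).indicator
      fun b => mixingDensity (c / 2) b * (1 / √(y ^ 2 - b ^ 2)) := fun y => by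
    funext b; simp only [f, indicator, mem_ofPred_eq, mem_Iio]
  have hfb : ∀ b, (fun y => f (b, y)) = (Ioi b).indicator
      fun y => mixingDensity (c / 2) b * (1 / √(y ^ 2 - b ^ 2)) := fun b => by
    funext y; simp only [f, indicator, mem_ofPred_eq, mem_Ioi]
  have hIy : ∀ y ∈ Ioo 0 x, Iio y ∩ Ioo 0 x = Ioo 0 y := fun y hy => by
    ext b
    exact ⟨fun h => ⟨h.2.1, h.1⟩, fun h => ⟨h.2, h.1, h.2.trans hy.2⟩⟩
  have hIb : ∀ b ∈ Ioo 0 x, Ioo 0 x ∩ Ioi b = Ioo b x := fun b hb => by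
    ext y
    exact ⟨fun h => ⟨h.2, h.1.2⟩, fun h => ⟨⟨hb.1.trans h.1, h.2⟩, h.1⟩⟩
  have hy1 : ∀ y ∈ Ioo 0 x, IntegrableOn (fun b => f (b, y)) (Ioo 0 x) ∧
      ∫ b in Ioo 0 x, f (b, y) = field (c / 2) y := fun y hy => by
    rw [hfy, IntegrableOn, integrable_indicator_iff measurableSet_Iio, IntegrableOn,
      Measure.restrict_restrict measurableSet_Iio, integral_indicator measurableSet_Iio,
      Measure.restrict_restrict measurableSet_Iio, hIy y hy]
    exact integrableOn_and_integral_mixing_inv_sqrt ⟨hy.1, hy.2.trans_le hx⟩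
  have hb1 : ∀ b ∈ Ioo 0 x, ∫ y in Ioo 0 x, f (b, y) =
      mixingDensity (c / 2) b * logArcosh b x := fun b hb => by
    rw [hfb, setIntegral_indicator measurableSet_Ioi, hIb b hb, integral_const_mul,
      (integrableOn_and_integral_inv_sqrt hb.1 hb.2).2]
  have hint : Integrable f ((volume.restrict (Ioo 0 x)).prod (volume.restrict (Ioo 0 x))) := by
    rw [integrable_prod_iff' hf.aestronglyMeasurable]
    constructor
    · filter_upwards [ae_restrict_mem measurableSet_Ioo] with y hy using (hy1 y hy).1
    · refine Integrable.congr i1 ?_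
      filter_upwards [ae_restrict_mem measurableSet_Ioo] with y hy
      rw [← (hy1 y hy).2]
      exact setIntegral_congr_fun measurableSet_Ioo fun b hb =>
        (Real.norm_of_nonneg (hnn b hb.1 y)).symm
  refine ⟨hint.integral_prod_left.congr ?_, ?_⟩
  · filter_upwards [ae_restrict_mem measurableSet_Ioo] with b hb using hb1 b hb
  · have h := integral_integral_swap (f := fun b y => f (b, y)) hint
    rw [setIntegral_congr_fun measurableSet_Ioo hb1,
      setIntegral_congr_fun measurableSet_Ioo (fun y hy => (hy1 y hy).2), i2] at h
    exact h

/-! ### The equilibrium potential and the Euler–Lagrange conditions -/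

theorem integrableOn_log_sub (x R : ℝ) :
    IntegrableOn (fun y => Real.log (x - y)) (Icc (-R) R) := by
  rcases le_or_gt (-R) R with h | h
  · rw [← intervalIntegrable_iff_integrableOn_Icc_of_le h]
    have h1 : IntervalIntegrable Real.log volume (x + R) (x - R) :=
      intervalIntegral.intervalIntegrable_log'
    have := h1.comp_sub_left x
    convert this using 1 <;> ring
  · rw [Icc_eq_empty (not_le.2 h)]; simp

theorem integrable_equilibriumDensity_mul_log (A a x : ℝ) :
    Integrable (fun y => equilibriumDensity A a y * Real.log (x - y)) := by
  have h : IntegrableOn (fun y => equilibriumDensity A a y * Real.log (x - y)) (Icc (-a) a) :=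
    (integrableOn_log_sub x a).bdd_mul
      (measurable_equilibriumDensity A a).aestronglyMeasurable
      (Eventually.of_forall (norm_equilibriumDensity_le A a))
  exact (integrableOn_iff_integrable_of_support_subset fun y hy => by
    by_contra h'
    exact hy (by simp [equilibriumDensity_eq_zero fun hm => h' (Ioo_subset_Icc_self hm)])).1 h

/-- The logarithmic potential of the equilibrium density. -/
noncomputable def equilibriumPotential (A a x : ℝ) : ℝ :=
  ∫ y, equilibriumDensity A a y * Real.log (x - y)

/-- The constants log(b/2) cancel in the difference, so only arcsine laws with b < |x| contribute.
-/
theorem equilibriumPotential_sub {A a : ℝ} (hA : a ≤ A) (x : ℝ) :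
    equilibriumPotential A a x - equilibriumPotential A a 0 =
      ∫ b in Ioo 0 (min a |x|), mixingDensity A b * logArcosh b |x| := by
  have h : ∀ x, IntegrableOn (fun b => mixingDensity A b * (Real.log (b / 2) +
      (Iio |x|).indicator (fun b => logArcosh b |x|) b)) (Ioo 0 a) ∧
      equilibriumPotential A a x = ∫ b in Ioo 0 a, mixingDensity A b * (Real.log (b / 2) +
      (Iio |x|).indicator (fun b => logArcosh b |x|) b) := fun x => by
    obtain ⟨h1, h2⟩ := integral_equilibriumDensity_mul hA (φ := fun y => Real.log (x - y))
      (by fun_prop) (integrable_equilibriumDensity_mul_log A a x)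
    have he : ∀ b ∈ Ioo 0 a, mixingDensity A b * ∫ y, arcsineDensity b y * Real.log (x - y) =
        mixingDensity A b * (Real.log (b / 2) +
          (Iio |x|).indicator (fun b => logArcosh b |x|) b) := fun b hb => by
      rw [integral_arcsineDensity_mul_log hb.1]
    exact ⟨h1.congr_fun he measurableSet_Ioo, by
      rw [equilibriumPotential, h2]; exact setIntegral_congr_fun measurableSet_Ioo he⟩
  rw [(h x).2, (h 0).2, ← integral_sub (h x).1 (h 0).1]
  have hI : Ioo 0 a ∩ Iio |x| = Ioo 0 (min a |x|) := by
    ext b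
    simp only [mem_inter_iff, mem_Ioo, mem_Iio, lt_min_iff]
    tauto
  rw [← hI, ← setIntegral_indicator measurableSet_Iio]
  refine setIntegral_congr_fun measurableSet_Ioo fun b hb => ?_
  have h0 : b ∉ Iio |(0 : ℝ)| := by simpa using hb.1.le
  simp only [indicator_of_notMem h0, indicator_mul_right (Iio |x|) (mixingDensity A)]
  ring

theorem V₀_abs (c x : ℝ) : LogEnergy.V₀ c |x| = LogEnergy.V₀ c x := by
  rcases abs_choice x with h | h
  · rw [h]
  · rw [h, LogEnergy.V₀, LogEnergy.V₀, sub_neg_eq_add, ← sub_eq_add_neg]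
    ring

theorem V₀_sub_equilibriumPotential_eq {c a x : ℝ} (hA : a ≤ c / 2) (hx : |x| ≤ a) :
    LogEnergy.V₀ c x - equilibriumPotential (c / 2) a x =
      LogEnergy.V₀ c 0 - equilibriumPotential (c / 2) a 0 := by
  have h := equilibriumPotential_sub hA x
  rw [min_eq_right hx] at h
  rcases (abs_nonneg x).eq_or_lt with h0 | h0
  · rw [abs_eq_zero.1 h0.symm]
  · rw [(integrableOn_and_integral_mixing_logArcosh h0 (hx.trans hA)).2, V₀_abs] at h
    linarith

/-- V₀ collects the contributions of all b < |x|, the potential only those with b < a; the missing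
ones are nonnegative. -/
theorem V₀_sub_equilibriumPotential_ge {c a x : ℝ} (hA : a ≤ c / 2) (hx : |x| ≤ c / 2) :
    LogEnergy.V₀ c 0 - equilibriumPotential (c / 2) a 0 ≤
      LogEnergy.V₀ c x - equilibriumPotential (c / 2) a x := by
  have h := equilibriumPotential_sub hA x
  rcases (abs_nonneg x).eq_or_lt with h0 | h0
  · rw [abs_eq_zero.1 h0.symm]
  · obtain ⟨h1, h2⟩ := integrableOn_and_integral_mixing_logArcosh h0 hx
    have h3 : ∫ b in Ioo 0 (min a |x|), mixingDensity (c / 2) b * logArcosh b |x| ≤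
        ∫ b in Ioo 0 |x|, mixingDensity (c / 2) b * logArcosh b |x| := by
      refine setIntegral_mono_set h1 ?_ (Eventually.of_forall fun b hb =>
        ⟨hb.1, hb.2.trans_le (min_le_right _ _)⟩)
      filter_upwards [ae_restrict_mem measurableSet_Ioo] with b hb
      exact mul_nonneg (mixingDensity_nonneg hb.1.le) (logArcosh_nonneg hb.1 hb.2)
    rw [h2, V₀_abs] at h3
    linarith

/-! ### Positive definiteness of the logarithmic kernel -/

instance (c : ℝ) : IsFiniteMeasure (LogEnergy.intervalMeasure c) := by
  unfold LogEnergy.intervalMeasure; infer_instance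

/-- The quadratic form of a Gram kernel ∫φ(x,z)φ(y,z) is an integral of squares. The cases used are
indicators φ of half-lines and of intervals. -/
theorem integral_mul_gram {β : Type*} [MeasurableSpace β] {μ : Measure ℝ} [IsFiniteMeasure μ]
    {ν : Measure β} [IsFiniteMeasure ν] {f : ℝ → ℝ} (hf : Integrable f μ) {φ : ℝ → β → ℝ}
    (hφ : Measurable fun p : ℝ × β => φ p.1 p.2) (hφ1 : ∀ x z, |φ x z| ≤ 1) :
    ∫ p : ℝ × ℝ, f p.1 * f p.2 * ∫ z, φ p.1 z * φ p.2 z ∂ν ∂(μ.prod μ) =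
      ∫ z, (∫ x, f x * φ x z ∂μ) ^ 2 ∂ν := by
  have hint : Integrable (fun q : (ℝ × ℝ) × β => φ q.1.1 q.2 * φ q.1.2 q.2 *
      (f q.1.1 * f q.1.2)) ((μ.prod μ).prod ν) := by
    refine ((hf.mul_prod hf).comp_fst ν).bdd_mul (c := 1) ?_ (Eventually.of_forall fun q => ?_)
    · have h1 : Measurable fun q : (ℝ × ℝ) × β => φ q.1.1 q.2 :=
        hφ.comp (measurable_fst.fst.prodMk measurable_snd)
      have h2 : Measurable fun q : (ℝ × ℝ) × β => φ q.1.2 q.2 :=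
        hφ.comp (measurable_fst.snd.prodMk measurable_snd)
      exact (h1.mul h2).aestronglyMeasurable
    · rw [norm_mul, Real.norm_eq_abs, Real.norm_eq_abs]
      exact mul_le_one₀ (hφ1 _ _) (abs_nonneg _) (hφ1 _ _)
  have h := integral_integral_swap (f := fun (p : ℝ × ℝ) z => φ p.1 z * φ p.2 z *
      (f p.1 * f p.2)) hint
  have h1 : ∀ p : ℝ × ℝ, f p.1 * f p.2 * ∫ z, φ p.1 z * φ p.2 z ∂ν =
      ∫ z, φ p.1 z * φ p.2 z * (f p.1 * f p.2) ∂ν := fun p => by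
    rw [integral_mul_const, mul_comm]
  simp only [h1]
  rw [h]
  refine integral_congr_ae (Eventually.of_forall fun z => ?_)
  simp only
  rw [sq, ← integral_prod_mul]
  refine integral_congr_ae (Eventually.of_forall fun p => ?_)
  simp only
  ring

theorem ae_mem_intervalMeasure_prod (c : ℝ) :
    ∀ᵐ p ∂((LogEnergy.intervalMeasure c).prod (LogEnergy.intervalMeasure c)),
      p.1 ∈ Icc (-(c / 2)) (c / 2) ∧ p.2 ∈ Icc (-(c / 2)) (c / 2) ∧ p.1 ≠ p.2 := by
  have hm : MeasurableSet {p : ℝ × ℝ | p.1 ∈ Icc (-(c / 2)) (c / 2) ∧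
      p.2 ∈ Icc (-(c / 2)) (c / 2) ∧ p.1 ≠ p.2} :=
    (measurable_fst measurableSet_Icc).inter ((measurable_snd measurableSet_Icc).inter
      (measurableSet_eq_fun measurable_fst measurable_snd).compl)
  have h := (Measure.ae_prod_mem_iff_ae_ae_mem (μ := LogEnergy.intervalMeasure c)
    (ν := LogEnergy.intervalMeasure c) hm).2
  refine h ?_
  have hmem : ∀ᵐ x ∂(LogEnergy.intervalMeasure c), x ∈ Icc (-(c / 2)) (c / 2) :=
    ae_restrict_mem measurableSet_Icc
  filter_upwards [hmem] with x hx
  have hne : ∀ᵐ y ∂(LogEnergy.intervalMeasure c), y ≠ x :=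
    ae_restrict_of_ae (Measure.ae_ne volume x)
  filter_upwards [hmem, hne] with y hy hyx
  exact ⟨hx, hy, hyx.symm⟩

/-- |x-y| = (x+c/2) + (y+c/2) - 2(min(x,y)+c/2). The one-variable terms vanish by mean zero, and
min(x,y)+c/2 is the Gram kernel of half-line indicators. -/
theorem integral_mul_abs_sub {c : ℝ} {f : ℝ → ℝ}
    (hf : Integrable f (LogEnergy.intervalMeasure c))
    (hf0 : ∫ x, f x ∂(LogEnergy.intervalMeasure c) = 0) :
    ∫ p : ℝ × ℝ, f p.1 * f p.2 * |p.1 - p.2|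
        ∂((LogEnergy.intervalMeasure c).prod (LogEnergy.intervalMeasure c)) =
      -2 * ∫ z in Icc (-(c / 2)) (c / 2),
        (∫ x, f x * (Iio x).indicator 1 z ∂(LogEnergy.intervalMeasure c)) ^ 2 := by
  set μ := LogEnergy.intervalMeasure c
  have hφ : Measurable fun p : ℝ × ℝ => (Iio p.1).indicator (1 : ℝ → ℝ) p.2 := by
    have : (fun p : ℝ × ℝ => (Iio p.1).indicator (1 : ℝ → ℝ) p.2) =
        {p : ℝ × ℝ | p.2 < p.1}.indicator 1 := by
      funext p; simp only [indicator, mem_Iio, mem_ofPred_eq, Pi.one_apply]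
    rw [this]
    exact measurable_one.indicator (measurableSet_lt measurable_snd measurable_fst)
  have hφ1 : ∀ x z : ℝ, |(Iio x).indicator (1 : ℝ → ℝ) z| ≤ 1 := fun x z => by
    by_cases h : z ∈ Iio x <;> simp [h]
  rw [← integral_mul_gram hf (ν := volume.restrict (Icc (-(c / 2)) (c / 2)))
    (φ := fun x z => (Iio x).indicator 1 z) hφ hφ1, ← integral_const_mul]
  have hx : Integrable (fun x => f x * (x + c / 2)) μ := by
    refine hf.mul_bdd (c := |c|) (by fun_prop) ?_
    have hmem : ∀ᵐ x ∂μ, x ∈ Icc (-(c / 2)) (c / 2) := ae_restrict_mem measurableSet_Icc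
    filter_upwards [hmem] with x hx
    rw [Real.norm_eq_abs, abs_of_nonneg (by linarith [hx.1])]
    exact le_trans (by linarith [hx.2]) (le_abs_self c)
  have hae : ∀ᵐ p ∂(μ.prod μ), f p.1 * f p.2 * |p.1 - p.2| =
      (f p.1 * (p.1 + c / 2) * f p.2 + f p.1 * (f p.2 * (p.2 + c / 2))) + -2 * (f p.1 * f p.2 *
        ∫ z in Icc (-(c / 2)) (c / 2), (Iio p.1).indicator 1 z * (Iio p.2).indicator 1 z) := by
    filter_upwards [ae_mem_intervalMeasure_prod c] with p hp
    obtain ⟨h1, h2, -⟩ := hp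
    have h3 : ∫ z in Icc (-(c / 2)) (c / 2), (Iio p.1).indicator (1 : ℝ → ℝ) z *
        (Iio p.2).indicator 1 z = min p.1 p.2 + c / 2 := by
      have : (fun z => (Iio p.1).indicator (1 : ℝ → ℝ) z * (Iio p.2).indicator 1 z) =
          (Iio (min p.1 p.2)).indicator 1 := by
        rw [← Iio_inter_Iio, inter_indicator_one]; rfl
      rw [this, setIntegral_indicator measurableSet_Iio]
      have hset : Icc (-(c / 2)) (c / 2) ∩ Iio (min p.1 p.2) = Ico (-(c / 2)) (min p.1 p.2) := by
        ext z
        have := min_le_left p.1 p.2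
        constructor
        · exact fun h => ⟨h.1.1, h.2⟩
        · exact fun h => ⟨⟨h.1, by linarith [h.2, h1.2]⟩, h.2⟩
      rw [hset]
      simp only [Pi.one_apply, integral_const, smul_eq_mul, mul_one, measureReal_restrict_apply_univ]
      rw [Real.volume_real_Ico_of_le (le_min h1.1 h2.1)]
      ring
    rw [h3]
    rcases le_total p.1 p.2 with h | h
    · rw [min_eq_left h, abs_of_nonpos (by linarith)]; ring
    · rw [min_eq_right h, abs_of_nonneg (by linarith)]; ring
  have hi1 : Integrable (fun p : ℝ × ℝ => f p.1 * (p.1 + c / 2) * f p.2) (μ.prod μ) :=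
    hx.mul_prod hf
  have hi2 : Integrable (fun p : ℝ × ℝ => f p.1 * (f p.2 * (p.2 + c / 2))) (μ.prod μ) :=
    hf.mul_prod hx
  have hi0 : Integrable (fun p : ℝ × ℝ => f p.1 * f p.2 * |p.1 - p.2|) (μ.prod μ) := by
    refine (hf.mul_prod hf).mul_bdd (c := |c|) (by fun_prop) ?_
    filter_upwards [ae_mem_intervalMeasure_prod c] with p hp
    obtain ⟨h1, h2, -⟩ := hp
    rw [Real.norm_eq_abs, abs_abs]
    exact abs_le.2 ⟨by linarith [h1.1, h2.2, le_abs_self c], by linarith [h1.2, h2.1, le_abs_self c]⟩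
  have hi3 := (hi0.sub (hi1.add hi2)).congr (g := fun p : ℝ × ℝ => -2 * (f p.1 * f p.2 *
        ∫ z in Icc (-(c / 2)) (c / 2), (Iio p.1).indicator 1 z * (Iio p.2).indicator 1 z)) (by
    filter_upwards [hae] with p hp
    simp only [Pi.sub_apply, Pi.add_apply]
    rw [hp]
    ring)
  have hi12 : Integrable (fun p : ℝ × ℝ => f p.1 * (p.1 + c / 2) * f p.2 +
      f p.1 * (f p.2 * (p.2 + c / 2))) (μ.prod μ) := hi1.add hi2
  rw [integral_congr_ae hae, integral_add hi12 hi3, integral_add hi1 hi2,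
    integral_prod_mul (fun x => f x * (x + c / 2)) f,
    integral_prod_mul f (fun x => f x * (x + c / 2)), hf0, mul_zero, zero_mul, add_zero, zero_add]

/-- The tent is the length of the intersection of the intervals of length r centred at x and y,
hence a Gram kernel. -/
theorem integral_mul_tent_nonneg {c r : ℝ} (hr : 0 < r) {f : ℝ → ℝ}
    (hf : Integrable f (LogEnergy.intervalMeasure c)) :
    0 ≤ ∫ p : ℝ × ℝ, f p.1 * f p.2 * max 0 (r - |p.1 - p.2|)
        ∂((LogEnergy.intervalMeasure c).prod (LogEnergy.intervalMeasure c)) := by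
  set μ := LogEnergy.intervalMeasure c
  let φ : ℝ → ℝ → ℝ := fun x z => (Ioo (x - r / 2) (x + r / 2)).indicator 1 z
  have hφ : Measurable fun p : ℝ × ℝ => φ p.1 p.2 := by
    have : (fun p : ℝ × ℝ => φ p.1 p.2) =
        {p : ℝ × ℝ | p.1 - r / 2 < p.2 ∧ p.2 < p.1 + r / 2}.indicator 1 := by
      funext p; simp only [φ, indicator, mem_Ioo, mem_ofPred_eq, Pi.one_apply]
    rw [this]
    exact measurable_one.indicator ((measurableSet_lt (measurable_fst.sub_const _)
      measurable_snd).inter (measurableSet_lt measurable_snd (measurable_fst.add_const _)))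
  have hφ1 : ∀ x z : ℝ, |φ x z| ≤ 1 := fun x z => by
    by_cases h : z ∈ Ioo (x - r / 2) (x + r / 2) <;> simp only [φ, h, indicator_of_mem,
      indicator_of_notMem, not_false_eq_true, Pi.one_apply, abs_one, abs_zero, le_refl, zero_le_one]
  have hae : ∀ᵐ p ∂(μ.prod μ), f p.1 * f p.2 * max 0 (r - |p.1 - p.2|) =
      f p.1 * f p.2 * ∫ z in Ioo (-(c / 2) - r) (c / 2 + r), φ p.1 z * φ p.2 z := by
    filter_upwards [ae_mem_intervalMeasure_prod c] with p hp
    obtain ⟨h1, h2, -⟩ := hp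
    congr 1
    have h3 : (fun z => φ p.1 z * φ p.2 z) =
        (Ioo (max (p.1 - r / 2) (p.2 - r / 2)) (min (p.1 + r / 2) (p.2 + r / 2))).indicator 1 := by
      rw [← Ioo_inter_Ioo, inter_indicator_one]; rfl
    rw [h3, setIntegral_indicator measurableSet_Ioo, inter_eq_right.2]
    · simp only [Pi.one_apply, integral_const, smul_eq_mul, mul_one, measureReal_restrict_apply_univ,
        Real.volume_real_Ioo]
      rw [max_comm 0]
      congr 1
      rcases le_total p.1 p.2 with h | h
      · rw [min_eq_left (by linarith), max_eq_right (by linarith), abs_of_nonpos (by linarith)]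
        ring
      · rw [min_eq_right (by linarith), max_eq_left (by linarith), abs_of_nonneg (by linarith)]
        ring
    · intro z hz
      have e1 := (le_max_left (p.1 - r / 2) (p.2 - r / 2)).trans_lt hz.1
      have e2 := hz.2.trans_le (min_le_left (p.1 + r / 2) (p.2 + r / 2))
      exact ⟨by linarith [h1.1], by linarith [h1.2]⟩
  rw [integral_congr_ae hae,
    integral_mul_gram hf (ν := volume.restrict (Ioo (-(c / 2) - r) (c / 2 + r))) hφ hφ1]
  exact integral_nonneg fun z => sq_nonneg _

/-- Superposing tents with weight 1/r² produces -log u. The cutoff R is needed for convergence and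
costs the constant and the term u/R. -/
theorem integrableOn_and_integral_tent {u R : ℝ} (hu : 0 < u) (huR : u < R) :
    IntegrableOn (fun r => max 0 (r - u) / r ^ 2) (Ioo 0 R) ∧
    ∫ r in Ioo 0 R, max 0 (r - u) / r ^ 2 = Real.log R - Real.log u - 1 + u / R := by
  let F : ℝ → ℝ := fun r => Real.log r + u / r
  have hder : ∀ r ∈ Ioo u R, HasDerivAt F ((r - u) / r ^ 2) r := by
    intro r hr
    have hr0 : r ≠ 0 := (hu.trans hr.1).ne'
    refine ((Real.hasDerivAt_log hr0).add ((hasDerivAt_inv hr0).const_mul u)).congr_deriv ?_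
    field_simp
    ring
  have hpos : ∀ r ∈ Ioo u R, 0 ≤ (r - u) / r ^ 2 := fun r hr =>
    div_nonneg (by linarith [hr.1]) (sq_nonneg r)
  have hc : ∀ r, 0 < r → ContinuousAt F r := fun r hr => by
    have := hr.ne'
    fun_prop (disch := assumption)
  have h0 : Tendsto F (𝓝[>] u) (𝓝 (F u)) := (hc u hu).continuousWithinAt
  have h1 : Tendsto F (𝓝[<] R) (𝓝 (F R)) := (hc R (hu.trans huR)).continuousWithinAt
  have heq : (fun r => max 0 (r - u) / r ^ 2) = (Ioi u).indicator fun r => (r - u) / r ^ 2 := by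
    funext r
    by_cases h : r ∈ Ioi u
    · rw [indicator_of_mem h, max_eq_right (by linarith [mem_Ioi.1 h])]
    · rw [indicator_of_notMem h, max_eq_left (by linarith [not_lt.1 (show ¬u < r from h)]), zero_div]
  have hI : Ioi u ∩ Ioo 0 R = Ioo u R := by
    ext r
    exact ⟨fun h => ⟨h.1, h.2.2⟩, fun h => ⟨h.1, hu.trans h.1, h.2⟩⟩
  rw [heq, IntegrableOn, integrable_indicator_iff measurableSet_Ioi, IntegrableOn,
    Measure.restrict_restrict measurableSet_Ioi, integral_indicator measurableSet_Ioi,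
    Measure.restrict_restrict measurableSet_Ioi, hI]
  refine ⟨integrableOn_Ioo_deriv_of_nonneg_of_tendsto huR hder hpos h0 h1, ?_⟩
  rw [integral_Ioo_eq_sub_of_hasDerivAt_of_nonneg_of_tendsto huR hder hpos h0 h1]
  simp only [F]
  rw [div_self hu.ne']
  ring

/-- Among mean-zero densities, the logarithmic energy dominates the square of the `L²` norm of the
distribution function. -/
theorem integral_mul_log_sub_le {c : ℝ} (hc : 0 < c) {f : ℝ → ℝ}
    (hf : Integrable f (LogEnergy.intervalMeasure c))
    (hf0 : ∫ x, f x ∂(LogEnergy.intervalMeasure c) = 0)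
    (hlog : Integrable (fun p : ℝ × ℝ => f p.1 * f p.2 * Real.log (p.1 - p.2))
      ((LogEnergy.intervalMeasure c).prod (LogEnergy.intervalMeasure c))) :
    ∫ p : ℝ × ℝ, f p.1 * f p.2 * Real.log (p.1 - p.2)
        ∂((LogEnergy.intervalMeasure c).prod (LogEnergy.intervalMeasure c)) ≤
      -(1 / c) * ∫ z in Icc (-(c / 2)) (c / 2),
        (∫ x, f x * (Iio x).indicator 1 z ∂(LogEnergy.intervalMeasure c)) ^ 2 := by
  have habs := integral_mul_abs_sub hf hf0
  have htent : ∀ r : ℝ, 0 < r → _ := fun r hr => integral_mul_tent_nonneg (r := r) hr hf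
  have hae := ae_mem_intervalMeasure_prod c
  set μ := LogEnergy.intervalMeasure c
  have hff : Integrable (fun p : ℝ × ℝ => f p.1 * f p.2) (μ.prod μ) := hf.mul_prod hf
  have hff0 : ∫ p : ℝ × ℝ, f p.1 * f p.2 ∂(μ.prod μ) = 0 := by
    rw [integral_prod_mul, hf0, zero_mul]
  -- Distances are at most c, so the cutoff 2c exceeds them strictly.
  have hu : ∀ p : ℝ × ℝ, p.1 ∈ Icc (-(c / 2)) (c / 2) ∧ p.2 ∈ Icc (-(c / 2)) (c / 2) ∧
      p.1 ≠ p.2 → 0 < |p.1 - p.2| ∧ |p.1 - p.2| < 2 * c := fun p hp =>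
    ⟨abs_pos.2 (sub_ne_zero.2 hp.2.2), abs_lt.2 ⟨by linarith [hp.1.1, hp.2.1.2],
      by linarith [hp.1.2, hp.2.1.1]⟩⟩
  have hi0 : Integrable (fun p : ℝ × ℝ => f p.1 * f p.2 * |p.1 - p.2|) (μ.prod μ) := by
    refine hff.mul_bdd (c := 2 * c) (by fun_prop) ?_
    filter_upwards [hae] with p hp
    rw [Real.norm_eq_abs, abs_abs]
    exact (hu p hp).2.le
  -- The superposition of tents times f(x)f(y). Its constant term integrates to zero; its linear
  -- term |x-y|/(2c) supplies the quantitative gain.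
  let T : ℝ × ℝ → ℝ := fun p => f p.1 * f p.2 * (Real.log (2 * c) - 1) -
    f p.1 * f p.2 * Real.log (p.1 - p.2) + f p.1 * f p.2 * |p.1 - p.2| / (2 * c)
  have hT : Integrable T (μ.prod μ) := ((hff.mul_const _).sub hlog).add (hi0.div_const _)
  have hTint : ∫ p, T p ∂(μ.prod μ) = -(∫ p : ℝ × ℝ, f p.1 * f p.2 * Real.log (p.1 - p.2)
      ∂(μ.prod μ)) + (∫ p : ℝ × ℝ, f p.1 * f p.2 * |p.1 - p.2| ∂(μ.prod μ)) / (2 * c) := by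
    have e1 := integral_add ((hff.mul_const (Real.log (2 * c) - 1)).sub hlog)
      (hi0.div_const (2 * c))
    have e2 := integral_sub (hff.mul_const (Real.log (2 * c) - 1)) hlog
    rw [integral_mul_const, hff0, zero_mul, zero_sub] at e2
    rw [integral_div] at e1
    simp only [Pi.sub_apply] at e1
    rw [e2] at e1
    exact e1
  let g : (ℝ × ℝ) × ℝ → ℝ := fun q => f q.1.1 * f q.1.2 *
    (max 0 (q.2 - |q.1.1 - q.1.2|) / q.2 ^ 2)
  have hslice : ∀ᵐ p ∂(μ.prod μ), IntegrableOn (fun r => g (p, r)) (Ioo 0 (2 * c)) ∧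
      ∫ r in Ioo 0 (2 * c), g (p, r) = T p ∧
      ∫ r in Ioo 0 (2 * c), ‖g (p, r)‖ = |f p.1 * f p.2| * (Real.log (2 * c) -
        Real.log (p.1 - p.2) - 1 + |p.1 - p.2| / (2 * c)) := by
    filter_upwards [hae] with p hp
    obtain ⟨hu1, hu2⟩ := hu p hp
    obtain ⟨t1, t2⟩ := integrableOn_and_integral_tent hu1 hu2
    rw [Real.log_abs] at t2
    refine ⟨t1.const_mul (f p.1 * f p.2), ?_, ?_⟩
    · simp only [g, T]
      rw [integral_const_mul, t2]
      ring
    · rw [← t2, ← integral_const_mul]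
      refine integral_congr_ae (Eventually.of_forall fun r => ?_)
      simp only [g]
      rw [norm_mul, Real.norm_eq_abs,
        Real.norm_of_nonneg (div_nonneg (le_max_left _ _) (sq_nonneg r))]
  have hgint : Integrable g ((μ.prod μ).prod (volume.restrict (Ioo 0 (2 * c)))) := by
    have hm : AEStronglyMeasurable g ((μ.prod μ).prod (volume.restrict (Ioo 0 (2 * c)))) := by
      refine hff.aestronglyMeasurable.comp_fst.mul ?_
      have : Measurable fun q : (ℝ × ℝ) × ℝ => max 0 (q.2 - |q.1.1 - q.1.2|) / q.2 ^ 2 := by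
        fun_prop
      exact this.aestronglyMeasurable
    rw [integrable_prod_iff hm]
    refine ⟨hslice.mono fun p hp => hp.1, ?_⟩
    refine (hT.norm).congr ?_
    filter_upwards [hslice, hae] with p hp hp2
    obtain ⟨hu1, hu2⟩ := hu p hp2
    obtain ⟨t1, t2⟩ := integrableOn_and_integral_tent hu1 hu2
    rw [Real.log_abs] at t2
    have hnn : 0 ≤ Real.log (2 * c) - Real.log (p.1 - p.2) - 1 + |p.1 - p.2| / (2 * c) := by
      rw [← t2]
      exact integral_nonneg fun r => div_nonneg (le_max_left _ _) (sq_nonneg r)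
    rw [hp.2.2, ← abs_of_nonneg hnn, ← abs_mul, Real.norm_eq_abs]
    congr 1
    simp only [T]
    ring
  have hswap := integral_integral_swap (f := fun p r => g (p, r)) hgint
  rw [integral_congr_ae (hslice.mono fun p hp => hp.2.1)] at hswap
  have hnonneg : 0 ≤ ∫ r in Ioo 0 (2 * c), ∫ p, g (p, r) ∂(μ.prod μ) := by
    refine setIntegral_nonneg measurableSet_Ioo fun r hr => ?_
    have : ∀ p : ℝ × ℝ, g (p, r) = f p.1 * f p.2 * max 0 (r - |p.1 - p.2|) / r ^ 2 := fun p => by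
      simp only [g]; ring
    simp only [this]
    rw [integral_div]
    exact div_nonneg (htent r hr.1) (sq_nonneg r)
  rw [← hswap, hTint, habs] at hnonneg
  have : ∀ S : ℝ, -2 * S / (2 * c) = -(1 / c) * S := fun S => by field_simp
  rw [this] at hnonneg
  linarith

/-- The tail integral is continuous, so it vanishes throughout the open interval; Lebesgue
differentiation then gives f = 0 almost everywhere. -/
theorem ae_eq_zero_of_integral_sq_tail_eq_zero {c : ℝ} {f : ℝ → ℝ}
    (hf : Integrable f (LogEnergy.intervalMeasure c))
    (h : ∫ z in Icc (-(c / 2)) (c / 2),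
        (∫ x, f x * (Iio x).indicator 1 z ∂(LogEnergy.intervalMeasure c)) ^ 2 ≤ 0) :
    f =ᵐ[LogEnergy.intervalMeasure c] 0 := by
  set g : ℝ → ℝ := (Icc (-(c / 2)) (c / 2)).indicator f
  have hg : Integrable g := (integrable_indicator_iff measurableSet_Icc).2 hf
  have htail : ∀ z, ∫ x, f x * (Iio x).indicator 1 z ∂(LogEnergy.intervalMeasure c) =
      (∫ x, g x) - ∫ x in Iic z, g x := fun z => by
    rw [← integral_add_compl (measurableSet_Iic (a := z)) hg, compl_Iic, add_sub_cancel_left,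
      LogEnergy.intervalMeasure, ← integral_indicator measurableSet_Icc,
      ← integral_indicator measurableSet_Ioi]
    refine integral_congr_ae (Eventually.of_forall fun x => ?_)
    by_cases hx : z < x <;> by_cases hx2 : x ∈ Icc (-(c / 2)) (c / 2) <;>
      simp only [g, indicator, mem_Iio, mem_Ioi, hx, hx2, if_true, if_false, Pi.one_apply,
        mul_one, mul_zero]
  simp only [htail] at h
  have hprim : ∀ x y, ∫ t in x..y, g t = (∫ t in Iic y, g t) - ∫ t in Iic x, g t := fun x y =>
    (intervalIntegral.integral_Iic_sub_Iic hg.integrableOn hg.integrableOn).symm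
  set F : ℝ → ℝ := fun z => (∫ x, g x) - ∫ x in Iic z, g x
  have hFc : Continuous F := by
    have h1 : F = fun z => F 0 - ∫ t in (0)..z, g t := by
      funext z
      rw [hprim]
      simp only [F]
      ring
    rw [h1]
    exact continuous_const.sub (intervalIntegral.continuous_primitive
      (fun a b => hg.intervalIntegrable) 0)
  have hF0 : EqOn F 0 (Ioo (-(c / 2)) (c / 2)) := by
    have hi : IntegrableOn (fun z => F z ^ 2) (Icc (-(c / 2)) (c / 2)) :=
      (hFc.pow 2).continuousOn.integrableOn_Icc
    have h0 := (setIntegral_eq_zero_iff_of_nonneg_ae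
      (Eventually.of_forall fun z => sq_nonneg (F z)) hi).1
      (le_antisymm h (integral_nonneg fun z => sq_nonneg _))
    have h1 : F =ᵐ[volume.restrict (Ioo (-(c / 2)) (c / 2))] 0 := by
      filter_upwards [h0.filter_mono (ae_mono (Measure.restrict_mono Ioo_subset_Icc_self le_rfl))]
        with z hz
      simpa using hz
    exact Measure.eqOn_open_of_ae_eq h1 isOpen_Ioo hFc.continuousOn continuousOn_const
  have hder := LocallyIntegrable.ae_hasDerivAt_integral hg.locallyIntegrable
  have hIoo : f =ᵐ[volume.restrict (Ioo (-(c / 2)) (c / 2))] 0 := by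
    filter_upwards [ae_restrict_mem measurableSet_Ioo, ae_restrict_of_ae hder] with x hx hdx
    have h1 : (fun y => ∫ t in x..y, g t) =ᶠ[𝓝 x] fun _ => 0 := by
      filter_upwards [isOpen_Ioo.mem_nhds hx] with y hy
      have e1 := hF0 hx
      have e2 := hF0 hy
      simp only [F, Pi.zero_apply] at e1 e2
      rw [hprim]
      linarith
    have h2 := ((hdx x).congr_of_eventuallyEq h1.symm).unique (hasDerivAt_const x (0 : ℝ))
    have hgx : g x = f x := indicator_of_mem (Ioo_subset_Icc_self hx) f
    rwa [hgx] at h2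
  rw [LogEnergy.intervalMeasure]
  rwa [← Measure.restrict_congr_set Ioo_ae_eq_Icc]

/-! ### Mass, finiteness of the energies, and comparison with the minimizer -/

theorem integral_equilibriumDensity {A a : ℝ} (ha : 0 < a) (hA : a ≤ A) :
    ∫ x, equilibriumDensity A a x = (A - √(A ^ 2 - a ^ 2)) / 2 := by
  have h := (integral_equilibriumDensity_mul hA (φ := fun _ => 1) measurable_const
    (by simpa using integrable_equilibriumDensity A a)).2
  simp only [mul_one] at h
  rw [h, ← (integrableOn_and_integral_mixingDensity ha hA).2]
  refine setIntegral_congr_fun measurableSet_Ioo fun b hb => ?_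
  have h1 := integral_arcsineDensity_mul hb.1 fun _ => 1
  have hpi := Real.pi_pos
  simp only [mul_one, intervalIntegral.integral_const, smul_eq_mul, sub_zero] at h1
  rw [inv_mul_cancel₀ (by positivity)] at h1
  simp only [h1, mul_one]

theorem integral_intervalMeasure_of_support {c : ℝ} {g : ℝ → ℝ}
    (hg : ∀ x, x ∉ Icc (-(c / 2)) (c / 2) → g x = 0) :
    ∫ x, g x ∂(LogEnergy.intervalMeasure c) = ∫ x, g x :=
  setIntegral_eq_integral_of_forall_compl_eq_zero hg

theorem equilibriumDensity_eq_zero_of_notMem_Icc {A a x : ℝ} (hA : a ≤ A) (hx : x ∉ Icc (-A) A) :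
    equilibriumDensity A a x = 0 :=
  equilibriumDensity_eq_zero fun h => hx ⟨by linarith [h.1], by linarith [h.2]⟩

theorem integral_equilibriumDensity_mul_log {c a : ℝ} (hA : a ≤ c / 2) (x : ℝ) :
    ∫ y, equilibriumDensity (c / 2) a y * Real.log (x - y) ∂(LogEnergy.intervalMeasure c) =
      equilibriumPotential (c / 2) a x :=
  integral_intervalMeasure_of_support fun y hy => by
    rw [equilibriumDensity_eq_zero_of_notMem_Icc hA hy, zero_mul]

theorem integral_abs_log_sub_le {c x : ℝ} (hx : x ∈ Icc (-(c / 2)) (c / 2)) :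
    ∫ y, |Real.log (x - y)| ∂(LogEnergy.intervalMeasure c) ≤ ∫ y in Icc (-c) c, |Real.log y| := by
  have h0 : IntegrableOn (fun y => |Real.log y|) (Icc (-c) c) := by
    have := (integrableOn_log_sub 0 c).abs
    simpa [IntegrableOn] using this
  have hc : -(c / 2) ≤ c / 2 := hx.1.trans hx.2
  rw [LogEnergy.intervalMeasure, integral_Icc_eq_integral_Ioc, ← intervalIntegral.integral_of_le hc,
    intervalIntegral.integral_comp_sub_left (fun y => |Real.log y|) x,
    intervalIntegral.integral_of_le (by linarith), ← integral_Icc_eq_integral_Ioc]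
  refine setIntegral_mono_set h0 (Eventually.of_forall fun y => abs_nonneg _)
    (Eventually.of_forall fun y hy => ?_)
  exact ⟨by linarith [hy.1, hx.1], by linarith [hy.2, hx.2]⟩

/-- Mere integrability of σ suffices: since ρ ≤ 1/4, the integral of ρ(y)|log|x-y|| is bounded
uniformly in x. -/
theorem integrable_mul_equilibriumDensity_mul_log {c a : ℝ} {σ : ℝ → ℝ}
    (hσ : Integrable σ (LogEnergy.intervalMeasure c)) :
    Integrable (fun p : ℝ × ℝ => σ p.1 * equilibriumDensity (c / 2) a p.2 * Real.log (p.1 - p.2))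
      ((LogEnergy.intervalMeasure c).prod (LogEnergy.intervalMeasure c)) := by
  have hmem : ∀ᵐ x ∂(LogEnergy.intervalMeasure c), x ∈ Icc (-(c / 2)) (c / 2) :=
    ae_restrict_mem measurableSet_Icc
  have hlog : ∀ x, Integrable (fun y => Real.log (x - y)) (LogEnergy.intervalMeasure c) := fun x =>
    integrableOn_log_sub x (c / 2)
  set μ := LogEnergy.intervalMeasure c with hμ
  have hρm := measurable_equilibriumDensity (c / 2) a
  have hk : Measurable fun p : ℝ × ℝ => equilibriumDensity (c / 2) a p.2 * Real.log (p.1 - p.2) :=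
    (hρm.comp measurable_snd).mul (by fun_prop)
  have hρlog : ∀ x, Integrable (fun y => equilibriumDensity (c / 2) a y * Real.log (x - y)) μ :=
    fun x => (hlog x).bdd_mul hρm.aestronglyMeasurable
      (Eventually.of_forall (norm_equilibriumDensity_le _ _))
  have hm : AEStronglyMeasurable (fun p : ℝ × ℝ =>
      σ p.1 * (equilibriumDensity (c / 2) a p.2 * Real.log (p.1 - p.2))) (μ.prod μ) :=
    hσ.aestronglyMeasurable.comp_fst.mul hk.aestronglyMeasurable
  simp only [mul_assoc]
  rw [integrable_prod_iff hm]
  refine ⟨Eventually.of_forall fun x => (hρlog x).const_mul (σ x), ?_⟩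
  simp only [norm_mul (σ _), integral_const_mul]
  refine hσ.norm.mul_bdd (c := 1 / 4 * ∫ y in Icc (-c) c, |Real.log y|)
    hk.norm.stronglyMeasurable.integral_prod_right.aestronglyMeasurable ?_
  filter_upwards [hmem] with x hx
  rw [Real.norm_of_nonneg (integral_nonneg fun y => norm_nonneg _)]
  calc ∫ y, ‖equilibriumDensity (c / 2) a y * Real.log (x - y)‖ ∂μ
      ≤ ∫ y, 1 / 4 * |Real.log (x - y)| ∂μ := by
        refine integral_mono (hρlog x).norm ((hlog x).abs.const_mul _) fun y => ?_
        simp only [norm_mul, Real.norm_eq_abs (Real.log _)]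
        exact mul_le_mul_of_nonneg_right (norm_equilibriumDensity_le _ _ _) (abs_nonneg _)
    _ ≤ _ := by
        rw [integral_const_mul]
        exact mul_le_mul_of_nonneg_left (integral_abs_log_sub_le hx) (by norm_num)

theorem integrable_mul_V₀ {c : ℝ} {σ : ℝ → ℝ} (hσ : Integrable σ (LogEnergy.intervalMeasure c)) :
    Integrable (fun x => σ x * LogEnergy.V₀ c x) (LogEnergy.intervalMeasure c) := by
  obtain ⟨K, hK⟩ := isCompact_Icc.exists_bound_of_continuousOn
    (continuous_V₀ c).continuousOn (s := Icc (-(c / 2)) (c / 2))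
  refine hσ.mul_bdd (c := K) (continuous_V₀ c).aestronglyMeasurable ?_
  have hmem : ∀ᵐ x ∂(LogEnergy.intervalMeasure c), x ∈ Icc (-(c / 2)) (c / 2) :=
    ae_restrict_mem measurableSet_Icc
  filter_upwards [hmem] with x hx using hK x hx

theorem hasFiniteLogEnergy_iff {c : ℝ} {σ : ℝ → ℝ} :
    LogEnergy.HasFiniteLogEnergy c σ ↔
      Integrable (fun p : ℝ × ℝ => σ p.1 * σ p.2 * Real.log (p.1 - p.2))
        ((LogEnergy.intervalMeasure c).prod (LogEnergy.intervalMeasure c)) := by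
  simp only [LogEnergy.HasFiniteLogEnergy, Real.log_inv, Real.log_abs, mul_neg]
  exact integrable_neg_iff

theorem energy_eq {c : ℝ} {σ : ℝ → ℝ} (h : LogEnergy.HasFiniteLogEnergy c σ) :
    LogEnergy.energy c σ =
      ((-(1 / 2) * (∫ p : ℝ × ℝ, σ p.1 * σ p.2 * Real.log (p.1 - p.2)
        ∂((LogEnergy.intervalMeasure c).prod (LogEnergy.intervalMeasure c))) +
        ∫ x, σ x * LogEnergy.V₀ c x ∂(LogEnergy.intervalMeasure c) : ℝ) : EReal) := by
  rw [LogEnergy.energy, if_pos h, integral_prod _ (hasFiniteLogEnergy_iff.1 h)]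
  simp only [Real.log_inv, Real.log_abs, mul_neg, integral_neg, neg_mul]

theorem isProbDensity_equilibriumDensity {c a : ℝ} (hA : a ≤ c / 2)
    (h1 : ∫ x, equilibriumDensity (c / 2) a x = 1) :
    LogEnergy.IsProbDensity c (equilibriumDensity (c / 2) a) where
  integrable := (integrable_equilibriumDensity _ _).restrict
  nonneg := Eventually.of_forall (equilibriumDensity_nonneg _ _)
  integral_eq_one := by
    rw [integral_intervalMeasure_of_support fun x hx =>
      equilibriumDensity_eq_zero_of_notMem_Icc hA hx, h1]

theorem hasFiniteLogEnergy_equilibriumDensity (c a : ℝ) :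
    LogEnergy.HasFiniteLogEnergy c (equilibriumDensity (c / 2) a) :=
  hasFiniteLogEnergy_iff.2
    (integrable_mul_equilibriumDensity_mul_log (integrable_equilibriumDensity _ _).restrict)

theorem integrable_and_integral_mul_equilibriumPotential {c a : ℝ} (hA : a ≤ c / 2) {σ : ℝ → ℝ}
    (hσ : Integrable σ (LogEnergy.intervalMeasure c)) :
    Integrable (fun x => σ x * equilibriumPotential (c / 2) a x) (LogEnergy.intervalMeasure c) ∧
    ∫ p : ℝ × ℝ, σ p.1 * equilibriumDensity (c / 2) a p.2 * Real.log (p.1 - p.2)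
      ∂((LogEnergy.intervalMeasure c).prod (LogEnergy.intervalMeasure c)) =
      ∫ x, σ x * equilibriumPotential (c / 2) a x ∂(LogEnergy.intervalMeasure c) := by
  have h := integrable_mul_equilibriumDensity_mul_log (a := a) hσ
  have h2 : ∀ x, ∫ y, σ x * equilibriumDensity (c / 2) a y * Real.log (x - y)
      ∂(LogEnergy.intervalMeasure c) = σ x * equilibriumPotential (c / 2) a x := fun x => by
    simp only [mul_assoc]
    rw [integral_const_mul, integral_equilibriumDensity_mul_log hA]
  refine ⟨h.integral_prod_left.congr (Eventually.of_forall h2), ?_⟩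
  rw [integral_prod _ h]
  simp only [h2]

theorem integral_mul_V₀_sub_potential_eq {c a : ℝ} (hA : a ≤ c / 2)
    (h1 : ∫ x, equilibriumDensity (c / 2) a x = 1) :
    ∫ x, equilibriumDensity (c / 2) a x *
      (LogEnergy.V₀ c x - equilibriumPotential (c / 2) a x) ∂(LogEnergy.intervalMeasure c) =
      LogEnergy.V₀ c 0 - equilibriumPotential (c / 2) a 0 := by
  have h : ∀ x, equilibriumDensity (c / 2) a x *
      (LogEnergy.V₀ c x - equilibriumPotential (c / 2) a x) = equilibriumDensity (c / 2) a x *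
      (LogEnergy.V₀ c 0 - equilibriumPotential (c / 2) a 0) := fun x => by
    by_cases hx : x ∈ Ioo (-a) a
    · rw [V₀_sub_equilibriumPotential_eq hA (abs_lt.2 hx).le]
    · rw [equilibriumDensity_eq_zero hx, zero_mul, zero_mul]
  simp only [h]
  rw [integral_mul_const, (isProbDensity_equilibriumDensity hA h1).integral_eq_one, one_mul]

theorem integral_mul_V₀_sub_potential_ge {c a : ℝ} (hA : a ≤ c / 2) {σ : ℝ → ℝ}
    (hσ : LogEnergy.IsProbDensity c σ) :
    LogEnergy.V₀ c 0 - equilibriumPotential (c / 2) a 0 ≤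
      ∫ x, σ x * (LogEnergy.V₀ c x - equilibriumPotential (c / 2) a x)
        ∂(LogEnergy.intervalMeasure c) := by
  have hint : Integrable (fun x => σ x * (LogEnergy.V₀ c x - equilibriumPotential (c / 2) a x))
      (LogEnergy.intervalMeasure c) := by
    simp only [mul_sub]
    exact (integrable_mul_V₀ hσ.integrable).sub
      (integrable_and_integral_mul_equilibriumPotential hA hσ.integrable).1
  have h := integral_mono_ae
    (hσ.integrable.mul_const (LogEnergy.V₀ c 0 - equilibriumPotential (c / 2) a 0)) hint (by
      have hmem : ∀ᵐ x ∂(LogEnergy.intervalMeasure c), x ∈ Icc (-(c / 2)) (c / 2) :=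
        ae_restrict_mem measurableSet_Icc
      filter_upwards [hσ.nonneg, hmem] with x hx hx2
      exact mul_le_mul_of_nonneg_left (V₀_sub_equilibriumPotential_ge hA (abs_le.2 hx2)) hx)
  rwa [integral_mul_const, hσ.integral_eq_one, one_mul] at h

/-- With f = σ - ρ and U the potential of ρ, E[σ] - E[ρ] = ∫f(V₀-U) - ½∬f(x)f(y) log|x-y|. The first
term is nonnegative by the Euler–Lagrange conditions, the second is bounded below by the tail
integral. -/
theorem energy_sub_ge {c a : ℝ} (hc : 0 < c) (hA : a ≤ c / 2)
    (h1 : ∫ x, equilibriumDensity (c / 2) a x = 1) {σ : ℝ → ℝ}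
    (hσ : LogEnergy.IsProbDensity c σ) (hfin : LogEnergy.HasFiniteLogEnergy c σ) :
    (-(1 / 2) * (∫ p : ℝ × ℝ, equilibriumDensity (c / 2) a p.1 * equilibriumDensity (c / 2) a p.2 *
        Real.log (p.1 - p.2)
        ∂((LogEnergy.intervalMeasure c).prod (LogEnergy.intervalMeasure c))) +
        ∫ x, equilibriumDensity (c / 2) a x * LogEnergy.V₀ c x ∂(LogEnergy.intervalMeasure c)) +
      1 / (2 * c) * ∫ z in Icc (-(c / 2)) (c / 2),
        (∫ x, (σ x - equilibriumDensity (c / 2) a x) * (Iio x).indicator 1 z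
          ∂(LogEnergy.intervalMeasure c)) ^ 2 ≤
    -(1 / 2) * (∫ p : ℝ × ℝ, σ p.1 * σ p.2 * Real.log (p.1 - p.2)
        ∂((LogEnergy.intervalMeasure c).prod (LogEnergy.intervalMeasure c))) +
        ∫ x, σ x * LogEnergy.V₀ c x ∂(LogEnergy.intervalMeasure c) := by
  have hρ := isProbDensity_equilibriumDensity hA h1
  have w1 := integral_mul_V₀_sub_potential_eq hA h1
  have w2 := integral_mul_V₀_sub_potential_ge hA hσ
  obtain ⟨u1, u2⟩ := integrable_and_integral_mul_equilibriumPotential hA hσ.integrable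
  obtain ⟨v1, v2⟩ := integrable_and_integral_mul_equilibriumPotential hA hρ.integrable
  have iσρ := integrable_mul_equilibriumDensity_mul_log (a := a) hσ.integrable
  have iρρ := integrable_mul_equilibriumDensity_mul_log (a := a) hρ.integrable
  have iσσ := hasFiniteLogEnergy_iff.1 hfin
  have hf := hσ.integrable.sub hρ.integrable
  have hf0 : ∫ x, (σ x - equilibriumDensity (c / 2) a x) ∂(LogEnergy.intervalMeasure c) = 0 := by
    rw [integral_sub hσ.integrable hρ.integrable, hσ.integral_eq_one, hρ.integral_eq_one, sub_self]
  have hVσ := integrable_mul_V₀ hσ.integrable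
  have hVρ := integrable_mul_V₀ hρ.integrable
  have hpos := integral_mul_log_sub_le (c := c) (f := fun x => σ x - equilibriumDensity (c / 2) a x)
    hc hf hf0
  simp only [mul_sub] at w1 w2
  rw [integral_sub hVρ v1] at w1
  rw [integral_sub hVσ u1] at w2
  set ρ := equilibriumDensity (c / 2) a
  set μ := LogEnergy.intervalMeasure c
  have hsymm : ∀ p : ℝ × ℝ, σ p.swap.1 * ρ p.swap.2 * Real.log (p.swap.1 - p.swap.2) =
      ρ p.1 * σ p.2 * Real.log (p.1 - p.2) := fun p => by
    rw [Prod.fst_swap, Prod.snd_swap, ← neg_sub, Real.log_neg_eq_log, mul_comm (σ _)]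
  have iρσ : Integrable (fun p : ℝ × ℝ => ρ p.1 * σ p.2 * Real.log (p.1 - p.2)) (μ.prod μ) :=
    iσρ.swap.congr (Eventually.of_forall hsymm)
  have hswap : ∫ p : ℝ × ℝ, ρ p.1 * σ p.2 * Real.log (p.1 - p.2) ∂(μ.prod μ) =
      ∫ p : ℝ × ℝ, σ p.1 * ρ p.2 * Real.log (p.1 - p.2) ∂(μ.prod μ) := by
    rw [← integral_prod_swap fun p : ℝ × ℝ => σ p.1 * ρ p.2 * Real.log (p.1 - p.2)]
    exact integral_congr_ae (Eventually.of_forall fun p => (hsymm p).symm)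
  have hexp : ∀ p : ℝ × ℝ, (σ p.1 - ρ p.1) * (σ p.2 - ρ p.2) * Real.log (p.1 - p.2) =
      (σ p.1 * σ p.2 * Real.log (p.1 - p.2) - σ p.1 * ρ p.2 * Real.log (p.1 - p.2)) -
      (ρ p.1 * σ p.2 * Real.log (p.1 - p.2) - ρ p.1 * ρ p.2 * Real.log (p.1 - p.2)) :=
    fun p => by ring
  have i12 : Integrable (fun p : ℝ × ℝ => σ p.1 * σ p.2 * Real.log (p.1 - p.2) -
      σ p.1 * ρ p.2 * Real.log (p.1 - p.2)) (μ.prod μ) := iσσ.sub iσρ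
  have i34 : Integrable (fun p : ℝ × ℝ => ρ p.1 * σ p.2 * Real.log (p.1 - p.2) -
      ρ p.1 * ρ p.2 * Real.log (p.1 - p.2)) (μ.prod μ) := iρσ.sub iρρ
  simp only [hexp] at hpos
  have hJ := hpos (i12.sub i34)
  rw [integral_sub i12 i34, integral_sub iσσ iσρ, integral_sub iρσ iρρ, hswap, u2, v2] at hJ
  rw [v2]
  have hS : ∀ S : ℝ, 1 / (2 * c) * S = -(1 / 2) * (-(1 / c) * S) := fun S => by
    field_simp
  rw [hS]
  linarith

theorem mainTheorem3 (c : ℝ) (hc : 4 ≤ c) :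
    -- the formula makes sense, and the normalization fixes the endpoint
    (∀ a : ℝ, 0 < a → a ≤ c / 2 →
      (∀ x ∈ Set.Ioo (-a) a,
        LogEnergy.HasPV a x (LogEnergy.kernel c a x)
          (LogEnergy.pv a x (LogEnergy.kernel c a x))) ∧
      MeasureTheory.Integrable (LogEnergy.density c a) ∧
      ((∫ x, LogEnergy.density c a x) = 1 ↔ a = √(2 * c - 4))) ∧
    -- the endpoint is admissible, and the support is the whole interval
    0 < √(2 * c - 4) ∧ √(2 * c - 4) ≤ c / 2 ∧
    tsupport (LogEnergy.density c √(2 * c - 4)) =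
      Set.Icc (-√(2 * c - 4)) √(2 * c - 4) ∧
    -- it is a probability density of finite energy, and the unique minimizer
    LogEnergy.IsProbDensity c (LogEnergy.density c √(2 * c - 4)) ∧
    LogEnergy.energy c (LogEnergy.density c √(2 * c - 4)) ≠ ⊤ ∧
    ∀ σ : ℝ → ℝ, LogEnergy.IsProbDensity c σ →
      LogEnergy.energy c (LogEnergy.density c √(2 * c - 4)) ≤ LogEnergy.energy c σ ∧
      (LogEnergy.energy c σ = LogEnergy.energy c (LogEnergy.density c √(2 * c - 4)) →
        σ =ᵐ[LogEnergy.intervalMeasure c] LogEnergy.density c √(2 * c - 4)) := by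
  have hpos : 0 < 2 * c - 4 := by linarith
  have ha : 0 < √(2 * c - 4) := Real.sqrt_pos.2 hpos
  have ha2 : √(2 * c - 4) ^ 2 = 2 * c - 4 := Real.sq_sqrt hpos.le
  have hA : √(2 * c - 4) ≤ c / 2 := by
    rw [Real.sqrt_le_left (by linarith)]
    -- (c/2)² - (2c-4) = (c-4)²/4.
    nlinarith [sq_nonneg (c - 4)]
  have hmass : ∀ a : ℝ, 0 < a → a ≤ c / 2 →
      ((∫ x, equilibriumDensity (c / 2) a x) = 1 ↔ a = √(2 * c - 4)) := by
    intro a ha0 haA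
    rw [integral_equilibriumDensity ha0 haA]
    constructor
    · intro h
      have h1 : √((c / 2) ^ 2 - a ^ 2) = c / 2 - 2 := by linarith
      have h2 : √((c / 2) ^ 2 - a ^ 2) ^ 2 = (c / 2) ^ 2 - a ^ 2 := Real.sq_sqrt (by nlinarith)
      rw [h1] at h2
      rw [show 2 * c - 4 = a ^ 2 by linarith, Real.sqrt_sq ha0.le]
    · rintro rfl
      -- Here c ≥ 4 matters: the root of (c/2-2)² must be c/2-2, not its opposite.
      rw [ha2, show (c / 2) ^ 2 - (2 * c - 4) = (c / 2 - 2) ^ 2 by ring,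
        Real.sqrt_sq (by linarith)]
      ring
  have h1 := (hmass _ ha hA).2 rfl
  have hfinρ := hasFiniteLogEnergy_equilibriumDensity c √(2 * c - 4)
  have hprob := isProbDensity_equilibriumDensity hA h1
  rw [density_eq_equilibriumDensity ha hA]
  refine ⟨fun a ha0 haA => ⟨fun x hx => ?_, ?_, ?_⟩, ha, hA, tsupport_equilibriumDensity ha,
    hprob, ?_, fun σ hσ => ?_⟩
  · have h := hasPV_kernel ha0 haA hx
    rwa [h.pv_eq]
  · rw [density_eq_equilibriumDensity ha0 haA]
    exact integrable_equilibriumDensity _ _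
  · rw [density_eq_equilibriumDensity ha0 haA]
    exact hmass a ha0 haA
  · rw [energy_eq hfinρ]
    exact EReal.coe_ne_top _
  · by_cases hfin : LogEnergy.HasFiniteLogEnergy c σ
    · have h := energy_sub_ge (by linarith) hA h1 hσ hfin
      have hc0 : 0 < 1 / (2 * c) := one_div_pos.2 (by linarith)
      rw [energy_eq hfin, energy_eq hfinρ]
      constructor
      · rw [EReal.coe_le_coe_iff]
        refine le_trans (le_add_of_nonneg_right ?_) h
        exact mul_nonneg hc0.le (integral_nonneg fun z => sq_nonneg _)
      · intro heq
        rw [EReal.coe_eq_coe_iff] at heq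
        rw [heq] at h
        have hS := nonpos_of_mul_nonpos_right (add_le_iff_nonpos_right _ |>.1 h) hc0
        filter_upwards [ae_eq_zero_of_integral_sq_tail_eq_zero
          (hσ.integrable.sub hprob.integrable) hS] with x hx
        exact sub_eq_zero.1 hx
    · have htop : LogEnergy.energy c σ = ⊤ := if_neg hfin
      rw [htop, energy_eq hfinρ]
      exact ⟨le_top, fun h => absurd h.symm (EReal.coe_ne_top _)⟩
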